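/- Notation. For $x=(x_1,x_2,x_3)\in\mathbb R^3$ write $r=\sqrt{x_1^2+x_2^2}$ and $\partial_r=(x_1\partial_1+x_2\partial_2)/r$. A function is axisymmetric if it depends on $(r,x_3)$ only. Let $\Lambda=\sqrt{-\Delta}$ and $\Lambda'=\sqrt{-\partial_1^2-\partial_2^2}$ (on axisymmetric functions $\Lambda'=\sqrt{-\partial_r^2-\partial_r/r}$) be the Fourier multipliers with symbols $|\xi|$ and $|\xi'|=\sqrt{\xi_1^2+\xi_2^2}$ (for the transform with kernel $e^{-ix\cdot\xi}$). A subscript $r$ or $x_3$ denotes the derivative $\partial_r$ or $\partial_{x_3}$; $v^r(x)=v(-x)$; $H^\infty=\bigcap_{m\ge 0}H^m(\mathbb R^3)$. For $\nu\ge 0$ consider the scalar equation, with $a=v+v^r$ and $b=v-v^r$, $$\begin{aligned} 2\sqrt2\,\bigl[v_t-\nu(\partial_r^2+\tfrac{\partial_r}{r}+\partial_{x_3}^2)v\bigr] =\;&\Lambda'\Lambda^{-1}\bigl\{[(\Lambda')^{-1}a]_r\,[(\Lambda')^{-1}a]_{rx_3}\bigr\} -\Lambda'\Lambda^{-1}\bigl\{[(\Lambda')^{-1}\Lambda^{-1}b]_{rx_3}\,[\Lambda(\Lambda')^{-1}b]_r\bigr\}\\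 &+(\Lambda')^{-1}\Lambda^{-1}\partial_{x_3}\bigl\{[\Lambda^{-1}\Lambda'b]_r\,[\Lambda(\Lambda')^{-1}b]_r\bigr\} -(\Lambda')^{-1}\Lambda^{-1}\partial_{x_3}\bigl\{\Lambda^{-1}\Lambda'b\;\Lambda\Lambda'b\bigr\}\\ &+(\Lambda')^{-1}\bigl\{[\Lambda'\Lambda^{-1}b]_r\,[(\Lambda')^{-1}a]_{rx_3}\bigr\} -(\Lambda')^{-1}\bigl\{\Lambda'\Lambda^{-1}b\;[\Lambda'a]_{x_3}\bigr\}\\ &-\partial_{x_3}(\Lambda')^{-1}\Lambda^{-1}\bigl\{[(\Lambda')^{-1}a]_r\,[\Lambda'a]_r\bigr\} +\partial_{x_3}(\Lambda')^{-1}\Lambda^{-1}\bigl\{\Lambda'a\;\Lambda'a\bigr\}\\ &-(\Lambda')^{-1}\bigl\{[(\Lambda')^{-1}\Lambda^{-1}b]_{rx_3}\,[\Lambda'a]_r\bigr\} +(\Lambda')^{-1}\bigl\{[\Lambda'\Lambda^{-1}b]_{x_3}\,\Lambda'a\bigr\}. \end{aligned}\tag{S}$$ Inside the braces the multipliers are composed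 with the derivatives on the level of symbols (so $\partial_j(\Lambda')^{-1}$, $j=1,2$, has the bounded symbol $i\xi_j/|\xi'|$), and the two sides of (S) are compared through their Fourier transforms, almost everywhere in $\xi$. A smooth solution of (S) on $[0,T)$ is a real, axisymmetric $v$ with $v(t)\in C^\infty\cap H^\infty$ that is differentiable in time with respect to every $H^m$ norm and satisfies (S) for all $t\in[0,T)$. A smooth solution on $[0,T)$ of $$\partial_tu+u\cdot\nabla u+\nabla p=\nu\Delta u,\qquad \nabla\cdot u=0,\qquad u(0,\cdot)=u_0\tag{NS}$$ on $\mathbb R^3$ is a pair $(u,p)$ with $u(t),p(t)\in C^\infty$ for each $t$, $u\in C([0,T);H^m)$ for every $m$, satisfying (NS) pointwise. In both cases the Cauchy problem is said to blow up in finite time if there are $0<T<\infty$, a smooth solution on $[0,T)$ with the given initial datum, and an $m$ such that its $H^m$ norm satisfies $\limsup_{t\uparrow T}\|\cdot\|_{H^m}=\infty$. Theorem. Let $\nu\ge 0$. Suppose that there is a smooth axisymmetric scalar function $v_0(r,x_3)\in L^2(\mathbb R^3)$ such that equation (S) with initial datum $v_0$ blows up in finite time. Then there is a smooth divergence-free vector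 field $u_0\in L^2(\mathbb R^3)$ such that the Cauchy problem (NS), i.e. the Navier–Stokes equations if $\nu>0$ and the Euler equations if $\nu=0$, also blows up in finite time. -/

import Mathlib

open MeasureTheory Set Filter Topology
open scoped ENNReal NNReal ContDiff FourierTransform Laplacian

noncomputable section

namespace SelfDual

/-- Three-dimensional Euclidean space. -/
abbrev E3 : Type := EuclideanSpace ℝ (Fin 3)

/-! ### Fourier multipliers

Mathlib's convention for the Fourier transform is `𝓕 f ξ = ∫ exp (-2πi ⟨x, ξ⟩) f x dx`, so that
`∂_j` has the symbol `2πi ξ_j` and `√(-Δ)` has the symbol `2π|ξ|`. -/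

open Classical in
/-- The Fourier (Plancherel) transform of a square-integrable function. -/
def l2Fourier (f : E3 → ℂ) : E3 → ℂ :=
  if hf : MemLp f 2 volume then (𝓕 (hf.toLp f) : Lp ℂ 2 (volume : Measure E3)) else 0

open Classical in
/-- The inverse Fourier (Plancherel) transform of a square-integrable function. -/
def l2FourierInv (f : E3 → ℂ) : E3 → ℂ :=
  if hf : MemLp f 2 volume then (𝓕⁻ (hf.toLp f) : Lp ℂ 2 (volume : Measure E3)) else 0

/-- The Fourier multiplier with symbol `σ`, applied to `f`. -/
def multiplier (σ : E3 → ℂ) (f : E3 → ℂ) : E3 → ℂ :=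
  l2FourierInv (σ * l2Fourier f)

/-- The distance to the `x₃`-axis, `√(x₁² + x₂²)`. -/
def horizontalNorm (x : E3) : ℝ := Real.sqrt (x 0 ^ 2 + x 1 ^ 2)

/-- The symbol of `Λ = √(-Δ)`. -/
def symΛ : E3 → ℂ := fun ξ => ((2 * Real.pi * ‖ξ‖ : ℝ) : ℂ)

/-- The symbol of the horizontal operator `√(-∂_1² - ∂_2²)`, which on axisymmetric functions is
`√(-∂_r² - ∂_r / r)`. -/
def symΛh : E3 → ℂ := fun ξ => ((2 * Real.pi * horizontalNorm ξ : ℝ) : ℂ)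

/-- The symbol of `∂_j`. -/
def symD (j : Fin 3) : E3 → ℂ := fun ξ => ((2 * Real.pi * ξ j : ℝ) : ℂ) * Complex.I

/-- The radial derivative `∂_r = (x₁ ∂_1 + x₂ ∂_2) / r` of `σ(D) f`. The horizontal derivatives are
composed with `σ(D)` on the level of the symbols; thus for `σ = |ξ'|⁻¹` the derivative of `σ(D) f`
is given by the bounded multipliers `i ξ_j / |ξ'|`, for every square-integrable `f`. -/
def radialDeriv (σ : E3 → ℂ) (f : E3 → ℂ) (x : E3) : ℂ :=
  ((x 0 / horizontalNorm x : ℝ) : ℂ) * multiplier (symD 0 * σ) f x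
    + ((x 1 / horizontalNorm x : ℝ) : ℂ) * multiplier (symD 1 * σ) f x

/-! ### Sobolev classes -/

/-- The Sobolev norm of `H^m(ℝ³)`, i.e. `‖(1 + |ξ|²)^(m/2) f̂‖_{L²}`, of a real-valued
square-integrable function. -/
def sobolevNorm (m : ℕ) (f : E3 → ℝ) : ℝ≥0∞ :=
  eLpNorm (fun ξ : E3 => ((Real.sqrt (1 + ‖ξ‖ ^ 2) ^ m : ℝ) : ℂ) * l2Fourier (fun x => (f x : ℂ)) ξ)
    2 volume

/-- Smooth functions in `H^∞(ℝ³) = ⋂ₘ H^m(ℝ³)`. -/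
structure IsHInfty (f : E3 → ℝ) : Prop where
  contDiff : ContDiff ℝ ∞ f
  memLp : MemLp f 2 volume
  sobolevNorm_lt_top : ∀ m : ℕ, sobolevNorm m f < ⊤

/-- `g` is the time derivative of `f` at time `t ∈ I`, in the topology of every `H^m(ℝ³)`
(one-sided at an end point of the interval `I`). -/
def HasSobolevDerivWithinAt (f : ℝ → E3 → ℝ) (g : E3 → ℝ) (I : Set ℝ) (t : ℝ) : Prop :=
  ∀ m : ℕ, Tendsto (fun s : ℝ => sobolevNorm m (fun x => (f s x - f t x) / (s - t) - g x))
    (𝓝[I \ {t}] t) (𝓝 0)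

/-! ### The scalar equation -/

/-- `f` depends on `r = √(x₁² + x₂²)` and `x₃` only. -/
def IsAxisymmetric (f : E3 → ℝ) : Prop :=
  ∀ x y : E3, horizontalNorm x = horizontalNorm y → x 2 = y 2 → f x = f y

/-- The Fourier transform of the quadratic right-hand side of the scalar equation. Every factor
`{…}` is a product of two square-integrable functions, hence integrable, and is transformed by the
Fourier integral. Here `a = v + vʳ` and `b = v - vʳ`, where `vʳ(x) = v(-x)`. -/
def scalarRHS (v : E3 → ℝ) (ξ : E3) : ℂ :=
  let a : E3 → ℂ := fun x => ((v x + v (-x) : ℝ) : ℂ)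
  let b : E3 → ℂ := fun x => ((v x - v (-x) : ℝ) : ℂ)
  (symΛh * symΛ⁻¹) ξ *
      𝓕 (fun x => radialDeriv symΛh⁻¹ a x * radialDeriv (symΛh⁻¹ * symD 2) a x) ξ
  - (symΛh * symΛ⁻¹) ξ *
      𝓕 (fun x => radialDeriv (symΛh⁻¹ * symΛ⁻¹ * symD 2) b x *
        radialDeriv (symΛ * symΛh⁻¹) b x) ξ
  + (symΛh⁻¹ * symΛ⁻¹ * symD 2) ξ *
      𝓕 (fun x => radialDeriv (symΛ⁻¹ * symΛh) b x * radialDeriv (symΛ * symΛh⁻¹) b x) ξ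
  - (symΛh⁻¹ * symΛ⁻¹ * symD 2) ξ *
      𝓕 (fun x => multiplier (symΛ⁻¹ * symΛh) b x * multiplier (symΛ * symΛh) b x) ξ
  + (symΛh⁻¹) ξ *
      𝓕 (fun x => radialDeriv (symΛh * symΛ⁻¹) b x * radialDeriv (symΛh⁻¹ * symD 2) a x) ξ
  - (symΛh⁻¹) ξ *
      𝓕 (fun x => multiplier (symΛh * symΛ⁻¹) b x * multiplier (symΛh * symD 2) a x) ξ
  - (symD 2 * symΛh⁻¹ * symΛ⁻¹) ξ *
      𝓕 (fun x => radialDeriv symΛh⁻¹ a x * radialDeriv symΛh a x) ξ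
  + (symD 2 * symΛh⁻¹ * symΛ⁻¹) ξ *
      𝓕 (fun x => multiplier symΛh a x * multiplier symΛh a x) ξ
  - (symΛh⁻¹) ξ *
      𝓕 (fun x => radialDeriv (symΛh⁻¹ * symΛ⁻¹ * symD 2) b x * radialDeriv symΛh a x) ξ
  + (symΛh⁻¹) ξ *
      𝓕 (fun x => multiplier (symΛh * symΛ⁻¹ * symD 2) b x * multiplier symΛh a x) ξ

/-- `v` is a smooth axisymmetric solution on `[0, T)` of the scalar equation
`2√2 (v_t - ν Δ v) = …` with initial datum `v₀`: it is differentiable in time with values in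
`H^∞(ℝ³)`, and the Fourier transforms of both sides agree almost everywhere, at each time. -/
structure IsScalarSolution (ν T : ℝ) (v₀ : E3 → ℝ) (v : ℝ → E3 → ℝ) : Prop where
  initial : v 0 = v₀
  smooth : ∀ t ∈ Ico 0 T, IsHInfty (v t)
  axisymmetric : ∀ t ∈ Ico 0 T, IsAxisymmetric (v t)
  equation : ∀ t ∈ Ico 0 T, ∃ w : E3 → ℝ, IsHInfty w ∧
    HasSobolevDerivWithinAt v w (Ico 0 T) t ∧
    ∀ᵐ ξ : E3, ((2 * Real.sqrt 2 : ℝ) : ℂ) *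
      (l2Fourier (fun x => (w x : ℂ)) ξ
        + (ν : ℂ) * symΛ ξ ^ 2 * l2Fourier (fun x => (v t x : ℂ)) ξ) = scalarRHS (v t) ξ

/-- The scalar equation with initial datum `v₀` blows up in finite time: there are `0 < T < ∞` and a
smooth solution on `[0, T)` with `limsup_{t ↑ T} ‖v(t)‖_{H^m} = ∞` for some `m`. -/
def ScalarBlowsUp (ν : ℝ) (v₀ : E3 → ℝ) : Prop :=
  ∃ T : ℝ, 0 < T ∧ ∃ v : ℝ → E3 → ℝ, IsScalarSolution ν T v₀ v ∧
    ∃ m : ℕ, ∀ M : ℝ≥0, ∃ᶠ t in 𝓝[<] T, (M : ℝ≥0∞) < sobolevNorm m (v t)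

/-! ### The Navier-Stokes equations -/

/-- The divergence of a vector field on `ℝ³`. -/
def divergence (u : E3 → E3) (x : E3) : ℝ :=
  ∑ i : Fin 3, fderiv ℝ u x (EuclideanSpace.single i 1) i

/-- `(u, p)` is a smooth solution on `[0, T)` of the Navier-Stokes equations (the Euler equations if
`ν = 0`) `∂_t u + u·∇u + ∇p = ν Δu`, `∇·u = 0`, `u(0) = u₀`, continuous in time with values in
`H^∞(ℝ³)`. The equations hold pointwise; the time derivative at `t = 0` is one-sided. -/
structure IsNavierStokesSolution (ν T : ℝ) (u₀ : E3 → E3) (u : ℝ → E3 → E3) (p : ℝ → E3 → ℝ) :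
    Prop where
  initial : u 0 = u₀
  smooth : ∀ t ∈ Ico 0 T, ContDiff ℝ ∞ (u t) ∧ ∀ i : Fin 3, IsHInfty (fun x => u t x i)
  smooth_pressure : ∀ t ∈ Ico 0 T, ContDiff ℝ ∞ (p t)
  continuous : ∀ t ∈ Ico 0 T, ∀ (i : Fin 3) (m : ℕ),
    Tendsto (fun s : ℝ => sobolevNorm m (fun x => u s x i - u t x i)) (𝓝[Ico 0 T] t) (𝓝 0)
  divergence_free : ∀ t ∈ Ico 0 T, ∀ x : E3, divergence (u t) x = 0
  momentum : ∀ t ∈ Ico 0 T, ∀ x : E3, ∃ w : E3,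
    HasDerivWithinAt (fun s => u s x) w (Ico 0 T) t ∧
    w + fderiv ℝ (u t) x (u t x) + gradient (p t) x = ν • (Δ (u t)) x

/-- The Cauchy problem of the Navier-Stokes equations with initial velocity `u₀` blows up in finite
time: there are `0 < T < ∞` and a smooth solution on `[0, T)` with
`limsup_{t ↑ T} ‖u(t)‖_{H^m} = ∞` for some `m`. -/
def NavierStokesBlowsUp (ν : ℝ) (u₀ : E3 → E3) : Prop :=
  ∃ T : ℝ, 0 < T ∧ ∃ (u : ℝ → E3 → E3) (p : ℝ → E3 → ℝ), IsNavierStokesSolution ν T u₀ u p ∧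
    ∃ m : ℕ, ∀ M : ℝ≥0, ∃ᶠ t in 𝓝[<] T,
      (M : ℝ≥0∞) < ∑ i : Fin 3, sobolevNorm m (fun x => u t x i)

end SelfDual

end

open SelfDual

/-! Off the vertical axis, the vectors orthogonal to a frequency ξ are spanned by the toroidal unit
vector (-ξ₂, ξ₁, 0)/|ξ'| and the poloidal one (-ξ₁ξ₃, -ξ₂ξ₃, |ξ'|²)/(|ξ||ξ'|). A divergence-free
field thus amounts to two scalars. If the field is axisymmetric and odd under x ↦ -x, the toroidal
scalar can be taken even and the poloidal one odd, so both fit into one scalar v as its even and odd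
parts. The map `velocity` reverses this: a = v + vʳ drives the swirl, b = v - vʳ the poloidal part,
with the factor 1/√2. Navier–Stokes respects axial symmetry and oddness, and (S) is its projection
onto the two directions, added up.

To verify this, write u·∇u = ω × u + ∇|u|²/2 (`adv_eq_lamb_add`). Horizontal gradients of
axisymmetric functions all point along (x₁, x₂): their cross products vanish and their dot products
are products of radial derivatives. The vertical curl, the horizontal divergence and the third
component of ω × u then consist of exactly the braces of (S) (`curl_lamb`, `div_lamb`, `lamb_two`,
`scalarRHS_eq`). The toroidal terms have an even transform and the poloidal ones an odd transform,
so the single equation (S) splits into two (`scalar_equation_split`). Resolving the transform of ω ×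
u along ξ and the two unit vectors, the ξ component being absorbed by the pressure, gives the
momentum equation (`spectral_momentum`, `momentum`).

The passage from v to u has bounded symbols, hence regularity in time carries over. Projecting û
back on the two directions recovers v̂ by bounded symbols (`norm_le_sum_velSpec`), so an unbounded
H^m norm of v forces one of u.

All functions are inverse Fourier integrals of spectra with every polynomial weight in L²
(`HasSpectrum`), a class stable under products, derivatives and multipliers of polynomial growth.
Functions equal almost everywhere have spectra equal almost everywhere, and the latter gives
equality at every point. The singularity of the symbols on ξ' = 0, a null set, is therefore
harmless. -/

/-! ### Rapidly decaying spectra -/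

/-- The weight `√(1 + |ξ|²)`. -/
noncomputable def jb (ξ : E3) : ℝ := Real.sqrt (1 + ‖ξ‖ ^ 2)

theorem one_le_jb (ξ : E3) : 1 ≤ jb ξ := by
  rw [jb, Real.one_le_sqrt]; nlinarith [sq_nonneg ‖ξ‖]

theorem jb_pos (ξ : E3) : 0 < jb ξ := zero_lt_one.trans_le (one_le_jb ξ)

theorem norm_le_jb (ξ : E3) : ‖ξ‖ ≤ jb ξ := Real.le_sqrt_of_sq_le (by linarith)

theorem continuous_jb : Continuous jb := by unfold jb; fun_prop

theorem jb_neg (ξ : E3) : jb (-ξ) = jb ξ := by simp [jb]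

theorem jb_isometry (A : E3 ≃ₗᵢ[ℝ] E3) (ξ : E3) : jb (A ξ) = jb ξ := by simp [jb]

theorem jb_add_le (ξ η : E3) : jb (ξ + η) ≤ 2 * (jb ξ * jb η) := by
  have h1 : ‖ξ + η‖ ≤ ‖ξ‖ + ‖η‖ := norm_add_le _ _
  have e1 : jb ξ * jb η = Real.sqrt ((1 + ‖ξ‖ ^ 2) * (1 + ‖η‖ ^ 2)) := by
    rw [Real.sqrt_mul (by positivity)]; rfl
  rw [e1, jb]
  apply Real.sqrt_le_iff.2
  constructor
  · positivity
  · rw [mul_pow, Real.sq_sqrt (by positivity)]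
    have h2 : ‖ξ + η‖ ^ 2 ≤ (‖ξ‖ + ‖η‖) ^ 2 := by gcongr
    nlinarith [sq_nonneg (‖ξ‖ - ‖η‖), mul_nonneg (sq_nonneg ‖ξ‖) (sq_nonneg ‖η‖),
      sq_nonneg ‖ξ‖, sq_nonneg ‖η‖]

/-- All the weights `(1 + |ξ|²)^(m/2)` of `g` are square integrable. -/
def RapidL2 (g : E3 → ℂ) : Prop :=
  ∀ m : ℕ, MemLp (fun ξ => ((jb ξ ^ m : ℝ) : ℂ) * g ξ) 2 volume

/-- The square is (1 + |ξ|²)⁻², of decay order 4, which exceeds the dimension 3. This is why two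
extra powers of the weight are spent in every passage from L² to L¹ or from a sup bound to L². -/
theorem memLp_jb_inv_sq : MemLp (fun ξ : E3 => (jb ξ ^ 2)⁻¹) 2 volume := by
  have hm : Measurable (fun ξ : E3 => (jb ξ ^ 2)⁻¹) := (continuous_jb.measurable.pow_const 2).inv
  rw [memLp_two_iff_integrable_sq hm.aestronglyMeasurable]
  have h := integrable_rpow_neg_one_add_norm_sq (E := E3) (μ := volume) (r := 4)
    (by simp; norm_num)
  refine h.congr (Eventually.of_forall fun x => ?_)
  have hp : (0 : ℝ) < 1 + ‖x‖ ^ 2 := by positivity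
  simp only [jb]
  rw [Real.sq_sqrt hp.le, show (-4 / 2 : ℝ) = -2 by norm_num, Real.rpow_neg hp.le]
  norm_num

theorem RapidL2.memLp {g : E3 → ℂ} (hg : RapidL2 g) : MemLp g 2 volume := by
  simpa using hg 0

theorem RapidL2.aestronglyMeasurable {g : E3 → ℂ} (hg : RapidL2 g) :
    AEStronglyMeasurable g volume := hg.memLp.1

theorem RapidL2.congr {g g' : E3 → ℂ} (hg : RapidL2 g) (h : g =ᵐ[volume] g') : RapidL2 g' := by
  intro m
  refine (hg m).ae_eq ?_
  filter_upwards [h] with ξ hξ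
  rw [hξ]

theorem RapidL2.add {g g' : E3 → ℂ} (hg : RapidL2 g) (hg' : RapidL2 g') :
    RapidL2 (fun ξ => g ξ + g' ξ) := by
  intro m
  refine ((hg m).add (hg' m)).ae_eq (Eventually.of_forall fun ξ => ?_)
  simp [mul_add]

theorem RapidL2.const_mul {g : E3 → ℂ} (hg : RapidL2 g) (c : ℂ) :
    RapidL2 (fun ξ => c * g ξ) := by
  intro m
  refine ((hg m).const_mul c).ae_eq (Eventually.of_forall fun ξ => ?_)
  simp only; ring

theorem RapidL2.sub {g g' : E3 → ℂ} (hg : RapidL2 g) (hg' : RapidL2 g') :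
    RapidL2 (fun ξ => g ξ - g' ξ) := by
  have := hg.add (hg'.const_mul (-1))
  simpa [sub_eq_add_neg] using this

theorem RapidL2.zero : RapidL2 (fun _ => 0) := by
  intro m
  simp

theorem RapidL2.comp_isometry {g : E3 → ℂ} (hg : RapidL2 g) (A : E3 ≃ₗᵢ[ℝ] E3) :
    RapidL2 (fun ξ => g (A ξ)) := by
  intro m
  have := (hg m).comp_measurePreserving A.measurePreserving
  refine this.ae_eq (Eventually.of_forall fun ξ => ?_)
  simp [jb_isometry]

theorem RapidL2.conj {g : E3 → ℂ} (hg : RapidL2 g) :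
    RapidL2 (fun ξ => (starRingEnd ℂ) (g ξ)) := by
  intro m
  refine (hg m).mono ?_ (Eventually.of_forall fun ξ => ?_)
  · exact (Complex.continuous_ofReal.comp (continuous_jb.pow m)).aestronglyMeasurable.mul
      (Complex.continuous_conj.comp_aestronglyMeasurable hg.aestronglyMeasurable)
  · simp

/-- A measurable function dominated by a polynomial. -/
structure TemperedSymbol (σ : E3 → ℂ) : Prop where
  measurable : Measurable σ
  bound : ∃ (K : ℝ) (k : ℕ), ∀ ξ, ‖σ ξ‖ ≤ K * jb ξ ^ k

theorem RapidL2.of_norm_le {g : E3 → ℂ} (hg : RapidL2 g) {G : E3 → ℂ}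
    (hG : AEStronglyMeasurable G volume) {K : ℝ} {k : ℕ}
    (h : ∀ᵐ ξ, ‖G ξ‖ ≤ K * jb ξ ^ k * ‖g ξ‖) : RapidL2 G := by
  intro m
  refine (hg (m + k)).of_le_mul (c := K) ?_ ?_
  · exact (Complex.continuous_ofReal.comp (continuous_jb.pow m)).aestronglyMeasurable.mul hG
  · filter_upwards [h] with ξ hξ
    have hp := jb_pos ξ
    simp only [norm_mul, Complex.norm_real, norm_pow, Real.norm_eq_abs, abs_of_pos hp]
    calc jb ξ ^ m * ‖G ξ‖ ≤ jb ξ ^ m * (K * jb ξ ^ k * ‖g ξ‖) := by gcongr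
      _ = _ := by ring

theorem RapidL2.symbol_mul {g : E3 → ℂ} (hg : RapidL2 g) {σ : E3 → ℂ} (hσ : TemperedSymbol σ) :
    RapidL2 (fun ξ => σ ξ * g ξ) := by
  obtain ⟨K, k, h⟩ := hσ.bound
  refine hg.of_norm_le (hσ.measurable.aestronglyMeasurable.mul hg.aestronglyMeasurable)
    (K := K) (k := k) (Eventually.of_forall fun ξ => ?_)
  rw [norm_mul]
  gcongr
  exact h ξ

/-- Cauchy–Schwarz against the square-integrable weight `(jb ξ ^ 2)⁻¹`. Integrability makes the
inverse Fourier integral a genuine pointwise formula. -/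
theorem RapidL2.integrable_weight {g : E3 → ℂ} (hg : RapidL2 g) (m : ℕ) :
    Integrable (fun ξ => ((jb ξ ^ m : ℝ) : ℂ) * g ξ) volume := by
  have h1 : MemLp (fun ξ : E3 => (((jb ξ ^ 2)⁻¹ : ℝ) : ℂ)) 2 volume := memLp_jb_inv_sq.ofReal
  refine (h1.integrable_mul (hg (m + 2))).congr (Eventually.of_forall fun ξ => ?_)
  have hp : (jb ξ : ℂ) ≠ 0 := by exact_mod_cast (jb_pos ξ).ne'
  simp only [Pi.mul_apply]
  push_cast
  field_simp
  ring

theorem RapidL2.integrable {g : E3 → ℂ} (hg : RapidL2 g) : Integrable g volume := by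
  simpa using hg.integrable_weight 0

theorem RapidL2.integrable_norm_pow {g : E3 → ℂ} (hg : RapidL2 g) (n : ℕ) :
    Integrable (fun ξ => ‖ξ‖ ^ n * ‖g ξ‖) volume := by
  refine (hg.integrable_weight n).norm.mono' ?_ (Eventually.of_forall fun ξ => ?_)
  · exact (continuous_norm.pow n).aestronglyMeasurable.mul hg.aestronglyMeasurable.norm
  · have hp := jb_pos ξ
    simp only [norm_mul, norm_pow, Complex.norm_real, Real.norm_eq_abs, abs_of_pos hp, abs_norm]
    gcongr
    exact norm_le_jb ξ

/-- The `L¹` norm is controlled by the weighted `L²` norm of order two. -/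
theorem lintegral_enorm_le_weight {g : E3 → ℂ} (hg : AEStronglyMeasurable g volume) :
    ∫⁻ ξ, ‖g ξ‖ₑ ≤ eLpNorm (fun ξ : E3 => (jb ξ ^ 2)⁻¹) 2 volume *
      eLpNorm (fun ξ => ((jb ξ ^ 2 : ℝ) : ℂ) * g ξ) 2 volume := by
  rw [← eLpNorm_one_eq_lintegral_enorm]
  have hm : AEStronglyMeasurable (fun ξ => ((jb ξ ^ 2 : ℝ) : ℂ) * g ξ) volume :=
    (Complex.continuous_ofReal.comp (continuous_jb.pow 2)).aestronglyMeasurable.mul hg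
  have h := eLpNorm_smul_le_mul_eLpNorm (p := 2) (q := 2) (r := 1) hm memLp_jb_inv_sq.1
  refine le_trans (le_of_eq ?_) h
  refine congrArg (fun F : E3 → ℂ => eLpNorm F 1 volume) (funext fun ξ => ?_)
  have hp : (jb ξ : ℂ) ≠ 0 := by exact_mod_cast (jb_pos ξ).ne'
  simp only [Pi.smul_apply', Complex.real_smul]
  push_cast
  field_simp

/-! ### The Plancherel transform of integrable functions -/

theorem memLp_l2Fourier (f : E3 → ℂ) : MemLp (l2Fourier f) 2 volume := by
  unfold l2Fourier
  split_ifs with hf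
  · exact Lp.memLp _
  · exact MemLp.zero

theorem memLp_l2FourierInv (f : E3 → ℂ) : MemLp (l2FourierInv f) 2 volume := by
  unfold l2FourierInv
  split_ifs with hf
  · exact Lp.memLp _
  · exact MemLp.zero

theorem l2Fourier_congr {f f' : E3 → ℂ} (h : f =ᵐ[volume] f') : l2Fourier f = l2Fourier f' := by
  unfold l2Fourier
  by_cases hf : MemLp f 2 volume
  · have hf' : MemLp f' 2 volume := hf.ae_eq h
    rw [dif_pos hf, dif_pos hf', (MemLp.toLp_eq_toLp_iff hf hf').2 h]
  · have hf' : ¬ MemLp f' 2 volume := fun h' => hf (h'.ae_eq h.symm)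
    rw [dif_neg hf, dif_neg hf']

theorem l2FourierInv_congr {f f' : E3 → ℂ} (h : f =ᵐ[volume] f') :
    l2FourierInv f = l2FourierInv f' := by
  unfold l2FourierInv
  by_cases hf : MemLp f 2 volume
  · have hf' : MemLp f' 2 volume := hf.ae_eq h
    rw [dif_pos hf, dif_pos hf', (MemLp.toLp_eq_toLp_iff hf hf').2 h]
  · have hf' : ¬ MemLp f' 2 volume := fun h' => hf (h'.ae_eq h.symm)
    rw [dif_neg hf, dif_neg hf']

theorem l2Fourier_l2FourierInv {f : E3 → ℂ} (hf : MemLp f 2 volume) :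
    l2Fourier (l2FourierInv f) =ᵐ[volume] f := by
  have h1 : l2FourierInv f = (𝓕⁻ (hf.toLp f) : Lp ℂ 2 (volume : Measure E3)) := by
    rw [l2FourierInv, dif_pos hf]
  have h2 : MemLp (l2FourierInv f) 2 volume := memLp_l2FourierInv f
  rw [l2Fourier, dif_pos h2]
  have h3 : h2.toLp (l2FourierInv f) = 𝓕⁻ (hf.toLp f) := by
    apply Lp.ext
    refine (MemLp.coeFn_toLp h2).trans ?_
    rw [h1]
  rw [h3, FourierTransform.fourier_fourierInv_eq]
  exact MemLp.coeFn_toLp hf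

theorem l2FourierInv_l2Fourier {f : E3 → ℂ} (hf : MemLp f 2 volume) :
    l2FourierInv (l2Fourier f) =ᵐ[volume] f := by
  have h1 : l2Fourier f = (𝓕 (hf.toLp f) : Lp ℂ 2 (volume : Measure E3)) := by
    rw [l2Fourier, dif_pos hf]
  have h2 : MemLp (l2Fourier f) 2 volume := memLp_l2Fourier f
  rw [l2FourierInv, dif_pos h2]
  have h3 : h2.toLp (l2Fourier f) = 𝓕 (hf.toLp f) := by
    apply Lp.ext
    refine (MemLp.coeFn_toLp h2).trans ?_
    rw [h1]
  rw [h3, FourierTransform.fourierInv_fourier_eq]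
  exact MemLp.coeFn_toLp hf

theorem integral_smul_fourierInv_eq {f g : E3 → ℂ} (hf : Integrable f volume)
    (hg : Integrable g volume) : ∫ x, 𝓕⁻ f x * g x = ∫ x, f x * 𝓕⁻ g x := by
  -- The inverse transform is the Fourier integral for the negated pairing, which is again
  -- symmetric.
  have h := VectorFourier.integral_fourierIntegral_smul_eq_flip (μ := (volume : Measure E3))
    (ν := (volume : Measure E3)) (e := Real.fourierChar) (L := -(innerₗ E3))
    Real.continuous_fourierChar (by simp only [LinearMap.neg_apply, innerₗ_apply_apply]; fun_prop) hf hg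
  have e : (-(innerₗ E3)).flip = -(innerₗ E3) := by
    ext x y; simp [real_inner_comm]
  rw [e] at h
  exact h

theorem continuous_fourierInv {g : E3 → ℂ} (hg : Integrable g volume) : Continuous (𝓕⁻ g) := by
  have h := VectorFourier.fourierIntegral_continuous (μ := (volume : Measure E3))
    (e := Real.fourierChar) (L := -(innerₗ E3))
    Real.continuous_fourierChar (by simp only [LinearMap.neg_apply, innerₗ_apply_apply]; fun_prop) hg
  exact h

theorem integral_smul_fourier_eq {f g : E3 → ℂ} (hf : Integrable f volume)
    (hg : Integrable g volume) : ∫ x, 𝓕 f x * g x = ∫ x, f x * 𝓕 g x := by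
  have h := VectorFourier.integral_fourierIntegral_smul_eq_flip (μ := (volume : Measure E3))
    (ν := (volume : Measure E3)) (e := Real.fourierChar) (L := innerₗ E3)
    Real.continuous_fourierChar (by simp only [innerₗ_apply_apply]; fun_prop) hf hg
  rw [flip_innerₗ] at h
  exact h

theorem continuous_fourier {g : E3 → ℂ} (hg : Integrable g volume) : Continuous (𝓕 g) := by
  have h := VectorFourier.fourierIntegral_continuous (μ := (volume : Measure E3))
    (e := Real.fourierChar) (L := innerₗ E3)
    Real.continuous_fourierChar (by simp only [innerₗ_apply_apply]; fun_prop) hg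
  exact h

/-- The Plancherel transform is compatible with tempered distributions, so tested against a smooth
compactly supported function the transform moves onto the test function. Fubini moves it there for
the integral as well, and test functions separate locally integrable functions. -/
theorem l2FourierInv_eq_fourierInv {g : E3 → ℂ} (hg : Integrable g volume)
    (hg2 : MemLp g 2 volume) : l2FourierInv g =ᵐ[volume] 𝓕⁻ g := by
  apply ae_eq_of_integral_contDiff_smul_eq
  · exact (memLp_l2FourierInv g).locallyIntegrable (by norm_num)
  · exact (continuous_fourierInv hg).locallyIntegrable
  intro φ hφ hc
  have hc' : HasCompactSupport (fun x => (φ x : ℂ)) := hc.comp_left (g := fun r : ℝ => (r : ℂ)) rfl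
  have hφ' : ContDiff ℝ ∞ (fun x => (φ x : ℂ)) := Complex.ofRealCLM.contDiff.comp hφ
  set ψ : SchwartzMap E3 ℂ := hc'.toSchwartzMap hφ' with hψ
  have hψx : ∀ x, ψ x = (φ x : ℂ) := fun x => by simp [hψ]
  have h := congrArg (fun T => T ψ) (Lp.fourierInv_toTemperedDistribution_eq (hg2.toLp g))
  simp only [Lp.toTemperedDistribution_apply, TemperedDistribution.fourierInv_apply] at h
  have e1 : ∫ x, φ x • l2FourierInv g x = ∫ x, ψ x • (𝓕⁻ (hg2.toLp g) : Lp ℂ 2 (volume : Measure E3)) x := by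
    rw [l2FourierInv, dif_pos hg2]
    simp only [hψx, Complex.real_smul, smul_eq_mul]
  have e2 : ∫ x, (𝓕⁻ ψ) x • (hg2.toLp g) x = ∫ x, g x * 𝓕⁻ (⇑ψ) x := by
    refine integral_congr_ae ?_
    filter_upwards [MemLp.coeFn_toLp hg2] with x hx
    rw [hx, smul_eq_mul, mul_comm, SchwartzMap.fourierInv_coe]
  rw [e1, ← h, e2, ← integral_smul_fourierInv_eq hg ψ.integrable]
  simp only [hψx, Complex.real_smul]
  refine integral_congr_ae (Eventually.of_forall fun x => mul_comm _ _)

theorem l2Fourier_eq_fourier {f : E3 → ℂ} (hf : Integrable f volume)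
    (hf2 : MemLp f 2 volume) : l2Fourier f =ᵐ[volume] 𝓕 f := by
  apply ae_eq_of_integral_contDiff_smul_eq
  · exact (memLp_l2Fourier f).locallyIntegrable (by norm_num)
  · exact (continuous_fourier hf).locallyIntegrable
  intro φ hφ hc
  have hc' : HasCompactSupport (fun x => (φ x : ℂ)) := hc.comp_left (g := fun r : ℝ => (r : ℂ)) rfl
  have hφ' : ContDiff ℝ ∞ (fun x => (φ x : ℂ)) := Complex.ofRealCLM.contDiff.comp hφ
  set ψ : SchwartzMap E3 ℂ := hc'.toSchwartzMap hφ' with hψ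
  have hψx : ∀ x, ψ x = (φ x : ℂ) := fun x => by simp [hψ]
  have h := congrArg (fun T => T ψ) (Lp.fourier_toTemperedDistribution_eq (hf2.toLp f))
  simp only [Lp.toTemperedDistribution_apply, TemperedDistribution.fourier_apply] at h
  have e1 : ∫ x, φ x • l2Fourier f x =
      ∫ x, ψ x • (𝓕 (hf2.toLp f) : Lp ℂ 2 (volume : Measure E3)) x := by
    rw [l2Fourier, dif_pos hf2]
    simp only [hψx, Complex.real_smul, smul_eq_mul]
  have e2 : ∫ x, (𝓕 ψ) x • (hf2.toLp f) x = ∫ x, f x * 𝓕 (⇑ψ) x := by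
    refine integral_congr_ae ?_
    filter_upwards [MemLp.coeFn_toLp hf2] with x hx
    rw [hx, smul_eq_mul, mul_comm, SchwartzMap.fourier_coe]
  rw [e1, ← h, e2, ← integral_smul_fourier_eq hf ψ.integrable]
  simp only [hψx, Complex.real_smul]
  refine integral_congr_ae (Eventually.of_forall fun x => mul_comm _ _)

/-! ### Functions with a rapidly decaying spectrum -/

/-- `f` is the inverse Fourier integral of the rapidly decaying function `g`. -/
structure HasSpectrum (f g : E3 → ℂ) : Prop where
  rapid : RapidL2 g
  eq : f = 𝓕⁻ g

theorem RapidL2.hasSpectrum {g : E3 → ℂ} (hg : RapidL2 g) : HasSpectrum (𝓕⁻ g) g := ⟨hg, rfl⟩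

/-- The directional derivative along the `j`-th coordinate. -/
noncomputable def pd (j : Fin 3) (f : E3 → ℂ) (x : E3) : ℂ :=
  fderiv ℝ f x (EuclideanSpace.single j 1)

namespace HasSpectrum

variable {f g f' g' : E3 → ℂ}

theorem ae_eq_l2FourierInv (h : HasSpectrum f g) : l2FourierInv g =ᵐ[volume] f := by
  rw [h.eq]
  exact l2FourierInv_eq_fourierInv h.rapid.integrable h.rapid.memLp

theorem continuous (h : HasSpectrum f g) : Continuous f := by
  rw [h.eq]
  exact continuous_fourierInv h.rapid.integrable

theorem memLp (h : HasSpectrum f g) : MemLp f 2 volume :=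
  (memLp_l2FourierInv g).ae_eq h.ae_eq_l2FourierInv

theorem l2Fourier_ae_eq (h : HasSpectrum f g) : l2Fourier f =ᵐ[volume] g := by
  rw [← l2Fourier_congr h.ae_eq_l2FourierInv]
  exact l2Fourier_l2FourierInv h.rapid.memLp

/-- A spectrum is the Plancherel transform of its function, hence unique. This turns identities that
hold off the axis in physical space into identities between transforms. -/
theorem ae_unique (h : HasSpectrum f g) (h' : HasSpectrum f' g') (e : f =ᵐ[volume] f') :
    g =ᵐ[volume] g' := by
  have h1 := h.l2Fourier_ae_eq
  rw [l2Fourier_congr e] at h1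
  exact h1.symm.trans h'.l2Fourier_ae_eq

theorem congr_spectrum (h : HasSpectrum f g) (e : g =ᵐ[volume] g') : HasSpectrum f g' := by
  refine ⟨h.rapid.congr e, ?_⟩
  rw [h.eq]
  ext x
  rw [Real.fourierInv_eq_fourier_neg, Real.fourierInv_eq_fourier_neg]
  exact Real.fourier_congr_ae e _

theorem congr_fun (h : HasSpectrum f g) (e : f = f') : HasSpectrum f' g := e ▸ h

/-- The inverse Fourier integral ignores null sets, so symbol identities valid off a hyperplane give
identities at every point. -/
theorem eq_of_ae_eq (h : HasSpectrum f g) (h' : HasSpectrum f' g') (e : g =ᵐ[volume] g') :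
    f = f' := by
  rw [(h.congr_spectrum e).eq, h'.eq]

theorem add (h : HasSpectrum f g) (h' : HasSpectrum f' g') :
    HasSpectrum (fun x => f x + f' x) (fun ξ => g ξ + g' ξ) := by
  refine ⟨h.rapid.add h'.rapid, ?_⟩
  ext x
  rw [h.eq, h'.eq, Real.fourierInv_eq, Real.fourierInv_eq, Real.fourierInv_eq, ← integral_add]
  · simp only [smul_add]
  · simpa using (Real.fourierIntegral_convergent_iff (μ := (volume : Measure E3)) (-x)).2
      h.rapid.integrable
  · simpa using (Real.fourierIntegral_convergent_iff (μ := (volume : Measure E3)) (-x)).2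
      h'.rapid.integrable

theorem const_mul (h : HasSpectrum f g) (c : ℂ) :
    HasSpectrum (fun x => c * f x) (fun ξ => c * g ξ) := by
  refine ⟨h.rapid.const_mul c, ?_⟩
  ext x
  rw [h.eq, Real.fourierInv_eq, Real.fourierInv_eq, ← integral_const_mul]
  refine integral_congr_ae (Eventually.of_forall fun ξ => ?_)
  simp only [Circle.smul_def, smul_eq_mul]
  ring

theorem neg (h : HasSpectrum f g) : HasSpectrum (fun x => -f x) (fun ξ => -g ξ) := by
  simpa using h.const_mul (-1)

theorem sub (h : HasSpectrum f g) (h' : HasSpectrum f' g') :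
    HasSpectrum (fun x => f x - f' x) (fun ξ => g ξ - g' ξ) := by
  simpa [sub_eq_add_neg] using h.add h'.neg

theorem zero : HasSpectrum (fun _ => 0) (fun _ => 0) := by
  refine ⟨RapidL2.zero, ?_⟩
  ext x
  simp [Real.fourierInv_eq]

theorem sum {ι : Type*} (s : Finset ι) {F G : ι → E3 → ℂ} (h : ∀ i ∈ s, HasSpectrum (F i) (G i)) :
    HasSpectrum (fun x => ∑ i ∈ s, F i x) (fun ξ => ∑ i ∈ s, G i ξ) := by
  classical
  induction s using Finset.induction_on with
  | empty => simpa using zero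
  | insert a s ha ih =>
    simp only [Finset.sum_insert ha]
    exact (h a (Finset.mem_insert_self a s)).add
      (ih fun i hi => h i (Finset.mem_insert_of_mem hi))

theorem comp_isometry (h : HasSpectrum f g) (A : E3 ≃ₗᵢ[ℝ] E3) :
    HasSpectrum (fun x => f (A x)) (fun ξ => g (A ξ)) := by
  refine ⟨h.rapid.comp_isometry A, ?_⟩
  ext x
  rw [h.eq, ← Real.fourierInv_comp_linearIsometry]
  rfl

theorem comp_neg (h : HasSpectrum f g) : HasSpectrum (fun x => f (-x)) (fun ξ => g (-ξ)) :=
  h.comp_isometry (LinearIsometryEquiv.neg ℝ)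

theorem conj (h : HasSpectrum f g) :
    HasSpectrum (fun x => (starRingEnd ℂ) (f x)) (fun ξ => (starRingEnd ℂ) (g (-ξ))) := by
  refine ⟨(h.rapid.comp_isometry (LinearIsometryEquiv.neg ℝ)).conj, ?_⟩
  ext x
  rw [h.eq, Real.fourierInv_eq', Real.fourierInv_eq', ← integral_conj,
    ← integral_neg_eq_self (μ := (volume : Measure E3))]
  refine integral_congr_ae (Eventually.of_forall fun ξ => ?_)
  simp only [smul_eq_mul, map_mul, inner_neg_left, ← Complex.exp_conj, Complex.conj_ofReal,
    Complex.conj_I]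
  congr 2
  push_cast; ring

theorem contDiff (h : HasSpectrum f g) : ContDiff ℝ ∞ f := by
  have h1 : ContDiff ℝ ∞ (𝓕 g) := Real.contDiff_fourier (N := ⊤)
    fun n _ => h.rapid.integrable_norm_pow n
  have h2 : f = fun x => 𝓕 g (-x) := by
    ext x; rw [h.eq, Real.fourierInv_eq_fourier_neg]
  rw [h2]
  exact h1.comp contDiff_neg

theorem differentiable (h : HasSpectrum f g) : Differentiable ℝ f :=
  h.contDiff.differentiable (by simp)

theorem _root_.temperedSymbol_symD (j : Fin 3) : TemperedSymbol (symD j) := by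
  refine ⟨by unfold symD; fun_prop, 2 * Real.pi, 1, fun ξ => ?_⟩
  simp only [symD, norm_mul, Complex.norm_I, mul_one, Complex.norm_real, pow_one, norm_mul,
    Real.norm_eq_abs, abs_of_pos Real.pi_pos, abs_two]
  gcongr
  exact (PiLp.norm_apply_le ξ j).trans (norm_le_jb ξ)

theorem pd (h : HasSpectrum f g) (j : Fin 3) :
    HasSpectrum (pd j f) (fun ξ => symD j ξ * g ξ) := by
  refine ⟨h.rapid.symbol_mul (temperedSymbol_symD j), ?_⟩
  -- Mathlib's derivative formula is for the forward transform. The reflection supplies a second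
  -- minus sign, which cancels that of the kernel.
  have h2 : f = 𝓕 g ∘ Neg.neg := by
    ext x; rw [h.eq, Real.fourierInv_eq_fourier_neg]; rfl
  ext x
  have hd := Real.hasFDerivAt_fourier h.rapid.integrable
    (by simpa using h.rapid.integrable_norm_pow 1) (-x)
  have hd' : HasFDerivAt f _ x := h2 ▸ hd.comp x (hasFDerivAt_id x).neg
  rw [_root_.pd, hd'.fderiv, Real.fourierInv_eq_fourier_neg]
  have hi : Integrable (VectorFourier.fourierSMulRight (innerSL ℝ) g) (volume : Measure E3) := by
    refine (((h.rapid.integrable_norm_pow 1).const_mul (2 * Real.pi * ‖innerSL ℝ (E := E3)‖))).mono'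
      (h.rapid.aestronglyMeasurable.fourierSMulRight) (Eventually.of_forall fun v => ?_)
    refine (VectorFourier.norm_fourierSMulRight_le _ _ _).trans (le_of_eq (by ring))
  have e1 := Real.fourier_continuousLinearMap_apply hi (a := EuclideanSpace.single j 1) (v := -x)
  simp only [ContinuousLinearMap.comp_apply, neg_apply,
    ContinuousLinearMap.id_apply, map_neg]
  rw [e1, Real.fourier_eq, Real.fourier_eq, ← integral_neg]
  refine integral_congr_ae (Eventually.of_forall fun ξ => ?_)
  have e2 : (innerSL ℝ ξ) (EuclideanSpace.single j 1) = ξ j := by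
    rw [innerSL_apply_apply, EuclideanSpace.inner_single_right]; simp
  simp only [VectorFourier.fourierSMulRight_apply, e2, symD, Circle.smul_def, smul_eq_mul,
    Complex.real_smul]
  push_cast
  ring

theorem integrable_mul (h : HasSpectrum f g) (h' : HasSpectrum f' g') :
    Integrable (fun x => f x * f' x) volume := h.memLp.integrable_mul h'.memLp

end HasSpectrum

/-! ### Convolutions of spectra and products of functions -/

open scoped Convolution

theorem integral_weighted_mul_le {G G' : E3 → ℂ} (hG : MemLp G 2 volume)
    (hG' : MemLp G' 2 volume) (ξ : E3) :
    ∫ η, ‖G η‖ * ‖G' (ξ - η)‖ ≤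
      (∫ η, ‖G η‖ ^ 2) ^ (1 / 2 : ℝ) * (∫ η, ‖G' η‖ ^ 2) ^ (1 / 2 : ℝ) := by
  have h2 : MemLp (fun η => G' (ξ - η)) 2 volume :=
    hG'.comp_measurePreserving (Measure.measurePreserving_sub_left volume ξ)
  have h := integral_mul_norm_le_Lp_mul_Lq (μ := (volume : Measure E3)) (f := G)
    (g := fun η => G' (ξ - η)) (p := 2) (q := 2) Real.HolderConjugate.two_two
    (by simpa using hG) (by simpa using h2)
  have e : ∫ η, ‖G' (ξ - η)‖ ^ (2 : ℝ) = ∫ η, ‖G' η‖ ^ (2 : ℝ) :=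
    integral_sub_left_eq_self (fun η => ‖G' η‖ ^ (2 : ℝ)) volume ξ
  rw [e] at h
  simpa using h

theorem RapidL2.convolution {g g' : E3 → ℂ} (hg : RapidL2 g) (hg' : RapidL2 g') :
    RapidL2 (g ⋆[ContinuousLinearMap.mul ℂ ℂ] g') := by
  have hmeas : AEStronglyMeasurable (g ⋆[ContinuousLinearMap.mul ℂ ℂ] g') volume :=
    (hg.integrable.integrable_convolution _ hg'.integrable).1
  intro m
  -- The weight is submultiplicative up to the factor 2, so it distributes over the two factors of
  -- the convolution, and Cauchy–Schwarz bounds the weight of order m + 2 uniformly in ξ. The two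
  -- spare powers then give square integrability.
  set M : ℝ := 2 ^ (m + 2) *
    ((∫ η, ‖((jb η ^ (m + 2) : ℝ) : ℂ) * g η‖ ^ 2) ^ (1 / 2 : ℝ) *
      (∫ η, ‖((jb η ^ (m + 2) : ℝ) : ℂ) * g' η‖ ^ 2) ^ (1 / 2 : ℝ)) with hM
  refine memLp_jb_inv_sq.of_le_mul (c := M) ?_ (Eventually.of_forall fun ξ => ?_)
  · exact (Complex.continuous_ofReal.comp (continuous_jb.pow m)).aestronglyMeasurable.mul hmeas
  have hp := jb_pos ξ
  have h1 : jb ξ ^ (m + 2) * ‖(g ⋆[ContinuousLinearMap.mul ℂ ℂ] g') ξ‖ ≤ M := by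
    rw [hM]
    refine le_trans ?_ (mul_le_mul_of_nonneg_left
      (integral_weighted_mul_le (hg (m + 2)) (hg' (m + 2)) ξ) (by positivity))
    rw [← integral_const_mul]
    calc jb ξ ^ (m + 2) * ‖(g ⋆[ContinuousLinearMap.mul ℂ ℂ] g') ξ‖
        ≤ jb ξ ^ (m + 2) * ∫ η, ‖g η * g' (ξ - η)‖ := by
          gcongr
          exact norm_integral_le_integral_norm _
      _ = ∫ η, jb ξ ^ (m + 2) * ‖g η * g' (ξ - η)‖ := by rw [integral_const_mul]
      _ ≤ _ := by
          refine integral_mono_of_nonneg (Eventually.of_forall fun η => by positivity) ?_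
            (Eventually.of_forall fun η => ?_)
          · have h2 : MemLp (fun η => ((jb (ξ - η) ^ (m + 2) : ℝ) : ℂ) * g' (ξ - η)) 2 volume :=
              (hg' (m + 2)).comp_measurePreserving (Measure.measurePreserving_sub_left volume ξ)
            exact ((hg (m + 2)).norm.integrable_mul h2.norm).const_mul _
          · have hb : jb ξ ≤ 2 * (jb η * jb (ξ - η)) := by
              simpa using jb_add_le η (ξ - η)
            have hb' : jb ξ ^ (m + 2) ≤ (2 * (jb η * jb (ξ - η))) ^ (m + 2) := by gcongr
            have h3 := jb_pos η
            have h4 := jb_pos (ξ - η)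
            simp only [norm_mul, Complex.norm_real, norm_pow, Real.norm_eq_abs, abs_of_pos h3,
              abs_of_pos h4]
            calc _ ≤ (2 * (jb η * jb (ξ - η))) ^ (m + 2) * (‖g η‖ * ‖g' (ξ - η)‖) := by gcongr
              _ = _ := by ring
  simp only [norm_mul, Complex.norm_real, norm_pow, Real.norm_eq_abs, abs_of_pos hp, norm_inv]
  rw [← div_eq_mul_inv, le_div_iff₀ (by positivity)]
  calc _ = jb ξ ^ (m + 2) * ‖(g ⋆[ContinuousLinearMap.mul ℂ ℂ] g') ξ‖ := by ring
    _ ≤ M := h1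

theorem fourierInv_convolution {g g' : E3 → ℂ} (hg : Integrable g volume)
    (hg' : Integrable g' volume) (x : E3) :
    𝓕⁻ (g ⋆[ContinuousLinearMap.mul ℂ ℂ] g') x = 𝓕⁻ g x * 𝓕⁻ g' x := by
  simp only [Real.fourierInv_eq_fourier_neg]
  exact Real.fourier_mul_convolution_eq hg hg' _

namespace HasSpectrum

variable {f g f' g' : E3 → ℂ}

/-- The product has a rapidly decaying spectrum, given by its Fourier integral. -/
theorem mul (h : HasSpectrum f g) (h' : HasSpectrum f' g') :
    HasSpectrum (fun x => f x * f' x) (𝓕 fun x => f x * f' x) := by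
  have h1 : HasSpectrum (fun x => f x * f' x) (g ⋆[ContinuousLinearMap.mul ℂ ℂ] g') := by
    refine ⟨h.rapid.convolution h'.rapid, ?_⟩
    ext x
    rw [fourierInv_convolution h.rapid.integrable h'.rapid.integrable, h.eq, h'.eq]
  -- The spectrum arises as a convolution. By uniqueness it is also the Fourier integral of the
  -- product, the form in which (S) is written.
  exact h1.congr_spectrum (h1.l2Fourier_ae_eq.symm.trans
    (l2Fourier_eq_fourier (h.integrable_mul h') h1.memLp))

end HasSpectrum

/-! ### Smooth functions with Sobolev regularity of every order -/

theorem sobolevNorm_eq (m : ℕ) (f : E3 → ℝ) : sobolevNorm m f =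
    eLpNorm (fun ξ => ((jb ξ ^ m : ℝ) : ℂ) * l2Fourier (fun x => (f x : ℂ)) ξ) 2 volume := rfl

theorem sobolevNorm_eq_of_hasSpectrum {f : E3 → ℝ} {g : E3 → ℂ}
    (h : HasSpectrum (fun x => (f x : ℂ)) g) (m : ℕ) :
    sobolevNorm m f = eLpNorm (fun ξ => ((jb ξ ^ m : ℝ) : ℂ) * g ξ) 2 volume := by
  rw [sobolevNorm_eq]
  refine eLpNorm_congr_ae ?_
  filter_upwards [h.l2Fourier_ae_eq] with ξ hξ
  rw [hξ]

theorem rapidL2_l2Fourier {f : E3 → ℝ} (hf : IsHInfty f) :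
    RapidL2 (l2Fourier fun x => (f x : ℂ)) := by
  intro m
  exact ⟨(Complex.continuous_ofReal.comp (continuous_jb.pow m)).aestronglyMeasurable.mul
    (memLp_l2Fourier _).1, hf.sobolevNorm_lt_top m⟩

theorem hasSpectrum_of_isHInfty {f : E3 → ℝ} (hf : IsHInfty f) :
    HasSpectrum (fun x => (f x : ℂ)) (l2Fourier fun x => (f x : ℂ)) := by
  have hr := rapidL2_l2Fourier hf
  refine ⟨hr, ?_⟩
  have h1 : (fun x => (f x : ℂ)) =ᵐ[volume] 𝓕⁻ (l2Fourier fun x => (f x : ℂ)) :=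
    (l2FourierInv_l2Fourier hf.memLp.ofReal).symm.trans hr.hasSpectrum.ae_eq_l2FourierInv
  -- Plancherel inversion holds only almost everywhere; continuity of both sides makes it hold
  -- everywhere.
  exact MeasureTheory.Measure.eq_of_ae_eq h1
    (Complex.continuous_ofReal.comp hf.contDiff.continuous) hr.hasSpectrum.continuous

theorem isHInfty_of_hasSpectrum {f : E3 → ℝ} {g : E3 → ℂ}
    (h : HasSpectrum (fun x => (f x : ℂ)) g) : IsHInfty f where
  contDiff := by
    have := Complex.reCLM.contDiff.comp h.contDiff
    exact this
  memLp := by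
    have := h.memLp.re
    exact this
  sobolevNorm_lt_top m := by
    rw [sobolevNorm_eq_of_hasSpectrum h]
    exact (h.rapid m).2

/-! ### Fourier multipliers -/

theorem HasSpectrum.multiplier_ae_eq {f g σ : E3 → ℂ} (h : HasSpectrum f g)
    (hσ : RapidL2 fun ξ => σ ξ * g ξ) :
    multiplier σ f =ᵐ[volume] 𝓕⁻ fun ξ => σ ξ * g ξ := by
  have e : (σ * l2Fourier f) =ᵐ[volume] fun ξ => σ ξ * g ξ := by
    filter_upwards [h.l2Fourier_ae_eq] with ξ hξ
    rw [Pi.mul_apply, hξ]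
  rw [multiplier, l2FourierInv_congr e]
  exact hσ.hasSpectrum.ae_eq_l2FourierInv

/-- Functions with some rapidly decaying spectrum. -/
def IsSpectral (f : E3 → ℂ) : Prop := ∃ g, HasSpectrum f g

namespace IsSpectral

variable {f f' : E3 → ℂ}

theorem hasSpectrum (h : IsSpectral f) : HasSpectrum f (l2Fourier f) := by
  obtain ⟨g, hg⟩ := h
  exact hg.congr_spectrum hg.l2Fourier_ae_eq.symm

theorem add (h : IsSpectral f) (h' : IsSpectral f') : IsSpectral fun x => f x + f' x :=
  ⟨_, h.hasSpectrum.add h'.hasSpectrum⟩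

theorem sub (h : IsSpectral f) (h' : IsSpectral f') : IsSpectral fun x => f x - f' x :=
  ⟨_, h.hasSpectrum.sub h'.hasSpectrum⟩

theorem const_mul (h : IsSpectral f) (c : ℂ) : IsSpectral fun x => c * f x :=
  ⟨_, h.hasSpectrum.const_mul c⟩

theorem mul (h : IsSpectral f) (h' : IsSpectral f') : IsSpectral fun x => f x * f' x :=
  ⟨_, h.hasSpectrum.mul h'.hasSpectrum⟩

theorem pd (h : IsSpectral f) (j : Fin 3) : IsSpectral (pd j f) := ⟨_, h.hasSpectrum.pd j⟩

theorem sum {ι : Type*} (s : Finset ι) {F : ι → E3 → ℂ} (h : ∀ i ∈ s, IsSpectral (F i)) :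
    IsSpectral fun x => ∑ i ∈ s, F i x :=
  ⟨_, HasSpectrum.sum s fun i hi => (h i hi).hasSpectrum⟩

theorem differentiable (h : IsSpectral f) : Differentiable ℝ f := h.hasSpectrum.differentiable

theorem contDiff (h : IsSpectral f) : ContDiff ℝ ∞ f := h.hasSpectrum.contDiff

theorem memLp (h : IsSpectral f) : MemLp f 2 volume := h.hasSpectrum.memLp

theorem integrable_mul (h : IsSpectral f) (h' : IsSpectral f') :
    Integrable (fun x => f x * f' x) volume := h.memLp.integrable_mul h'.memLp

end IsSpectral

theorem pd_add {f g : E3 → ℂ} (hf : IsSpectral f) (hg : IsSpectral g) (j : Fin 3) (x : E3) :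
    pd j (fun y => f y + g y) x = pd j f x + pd j g x := by
  simp only [pd]
  rw [fderiv_fun_add (hf.differentiable x) (hg.differentiable x)]
  rfl

theorem pd_sub {f g : E3 → ℂ} (hf : IsSpectral f) (hg : IsSpectral g) (j : Fin 3) (x : E3) :
    pd j (fun y => f y - g y) x = pd j f x - pd j g x := by
  simp only [pd]
  rw [fderiv_fun_sub (hf.differentiable x) (hg.differentiable x)]
  rfl

theorem pd_const_mul {f : E3 → ℂ} (hf : IsSpectral f) (c : ℂ) (j : Fin 3) (x : E3) :
    pd j (fun y => c * f y) x = c * pd j f x := by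
  simp only [pd]
  rw [fderiv_const_mul (hf.differentiable x)]
  rfl

theorem pd_mul {f g : E3 → ℂ} (hf : IsSpectral f) (hg : IsSpectral g) (j : Fin 3) (x : E3) :
    pd j (fun y => f y * g y) x = pd j f x * g x + f x * pd j g x := by
  simp only [pd]
  rw [fderiv_fun_mul (hf.differentiable x) (hg.differentiable x)]
  simp only [add_apply, smul_apply, smul_eq_mul]
  ring

/-- The swirl potential gradient `h`, its vertical derivative `z`, the poloidal fields `k`, `l`, and
the scalars `α = Λ' a`, `β = Λ' Λ⁻¹ b`, `γ = Λ Λ' b` with their horizontal gradients and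
vertical derivatives, of an axisymmetric flow. -/
structure FieldSystem where
  (h0 h1 z0 z1 k0 k1 l0 l1 α α0 α1 αz β β0 β1 βz γ : E3 → ℂ)
  s_h0 : IsSpectral h0
  s_h1 : IsSpectral h1
  s_k0 : IsSpectral k0
  s_k1 : IsSpectral k1
  s_l0 : IsSpectral l0
  s_l1 : IsSpectral l1
  s_α : IsSpectral α
  s_β : IsSpectral β
  s_γ : IsSpectral γ
  curl_h : ∀ x, pd 0 h1 x = pd 1 h0 x
  div_h : ∀ x, pd 0 h0 x + pd 1 h1 x = -α x
  pd_h0 : pd 2 h0 = z0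
  pd_h1 : pd 2 h1 = z1
  curl_z : ∀ x, pd 0 z1 x = pd 1 z0 x
  div_z : ∀ x, pd 0 z0 x + pd 1 z1 x = -αz x
  curl_k : ∀ x, pd 0 k1 x = pd 1 k0 x
  div_k : ∀ x, pd 0 k0 x + pd 1 k1 x = -βz x
  pd_k0 : ∀ x, pd 2 k0 x = β0 x - l0 x
  pd_k1 : ∀ x, pd 2 k1 x = β1 x - l1 x
  curl_l : ∀ x, pd 0 l1 x = pd 1 l0 x
  div_l : ∀ x, pd 0 l0 x + pd 1 l1 x = -γ x
  pd0_α : pd 0 α = α0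
  pd1_α : pd 1 α = α1
  pd2_α : pd 2 α = αz
  pd0_β : pd 0 β = β0
  pd1_β : pd 1 β = β1
  pd2_β : pd 2 β = βz
  radial_h : ∀ x, (x 0 : ℂ) * h1 x = x 1 * h0 x
  radial_z : ∀ x, (x 0 : ℂ) * z1 x = x 1 * z0 x
  radial_k : ∀ x, (x 0 : ℂ) * k1 x = x 1 * k0 x
  radial_l : ∀ x, (x 0 : ℂ) * l1 x = x 1 * l0 x
  radial_α : ∀ x, (x 0 : ℂ) * α1 x = x 1 * α0 x
  radial_β : ∀ x, (x 0 : ℂ) * β1 x = x 1 * β0 x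

theorem ae_coord_zero_ne_zero : ∀ᵐ x : E3, x 0 ≠ 0 := by
  have h := Measure.addHaar_submodule (volume : Measure E3)
    (ℝ ∙ (EuclideanSpace.single 0 1 : E3))ᗮ (by
      intro h
      have h1 : (EuclideanSpace.single 0 1 : E3) ∈ (ℝ ∙ (EuclideanSpace.single 0 1 : E3))ᗮ :=
        h ▸ trivial
      rw [Submodule.mem_orthogonal_singleton_iff_inner_right,
        EuclideanSpace.inner_single_left] at h1
      simp at h1)
  rw [ae_iff]
  refine measure_mono_null (fun x hx => ?_) h
  rw [SetLike.mem_coe, Submodule.mem_orthogonal_singleton_iff_inner_right,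
    EuclideanSpace.inner_single_left]
  simpa using hx

theorem ae_off_axis : ∀ᵐ x : E3, ((x 0 : ℝ) : ℂ) ≠ 0 ∨ ((x 1 : ℝ) : ℂ) ≠ 0 := by
  filter_upwards [ae_coord_zero_ne_zero] with x hx
  exact Or.inl (Complex.ofReal_ne_zero.2 hx)

/-- Both vectors are parallel to the nonzero vector (p, q). The vanishing of these cross products is
where axial symmetry simplifies the nonlinearity. -/
theorem wedge_eq_zero {p q a0 a1 b0 b1 : ℂ} (hpq : p ≠ 0 ∨ q ≠ 0) (ha : p * a1 = q * a0)
    (hb : p * b1 = q * b0) : a0 * b1 = a1 * b0 := by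
  rcases hpq with hp | hq
  · refine mul_left_cancel₀ hp ?_
    linear_combination a0 * hb - b0 * ha
  · refine mul_left_cancel₀ hq ?_
    linear_combination a1 * hb - b1 * ha

/-! ### The advection term in Lamb form, with its vertical curl and horizontal divergence -/

namespace FieldSystem

variable (S : FieldSystem) (c : ℂ)

/-- The velocity field with swirl `h` and poloidal part `(k, β)`, scaled by `c`. -/
noncomputable def vel : Fin 3 → E3 → ℂ :=
  ![fun x => c * (S.k0 x - S.h1 x), fun x => c * (S.h0 x + S.k1 x), fun x => c * S.β x]

/-- The cross product of the vorticity with the velocity. -/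
noncomputable def lamb : Fin 3 → E3 → ℂ :=
  ![fun x => c ^ 2 * (S.α x * (S.h0 x + S.k1 x) - (S.l0 x + S.z1 x) * S.β x),
    fun x => c ^ 2 * (S.α x * (S.h1 x - S.k0 x) - (S.l1 x - S.z0 x) * S.β x),
    fun x => c ^ 2 * ((S.l1 x - S.z0 x) * (S.h0 x + S.k1 x)
      + (S.l0 x + S.z1 x) * (S.k0 x - S.h1 x))]

/-- The advection term `u · ∇u`. -/
noncomputable def adv (i : Fin 3) (x : E3) : ℂ :=
  ∑ j, S.vel c j x * pd j (S.vel c i) x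

/-- The kinetic energy density `|u|² / 2`. -/
noncomputable def energy (x : E3) : ℂ := (1 / 2) * ∑ j, S.vel c j x * S.vel c j x

theorem s_z0 : IsSpectral S.z0 := S.pd_h0 ▸ S.s_h0.pd 2
theorem s_z1 : IsSpectral S.z1 := S.pd_h1 ▸ S.s_h1.pd 2
theorem s_α0 : IsSpectral S.α0 := S.pd0_α ▸ S.s_α.pd 0
theorem s_α1 : IsSpectral S.α1 := S.pd1_α ▸ S.s_α.pd 1
theorem s_αz : IsSpectral S.αz := S.pd2_α ▸ S.s_α.pd 2
theorem s_β0 : IsSpectral S.β0 := S.pd0_β ▸ S.s_β.pd 0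
theorem s_β1 : IsSpectral S.β1 := S.pd1_β ▸ S.s_β.pd 1
theorem s_βz : IsSpectral S.βz := S.pd2_β ▸ S.s_β.pd 2

theorem s_vel (i : Fin 3) : IsSpectral (S.vel c i) := by
  fin_cases i
  · exact (S.s_k0.sub S.s_h1).const_mul c
  · exact (S.s_h0.add S.s_k1).const_mul c
  · exact S.s_β.const_mul c

theorem s_lamb (i : Fin 3) : IsSpectral (S.lamb c i) := by
  fin_cases i
  · exact ((S.s_α.mul (S.s_h0.add S.s_k1)).sub ((S.s_l0.add S.s_z1).mul S.s_β)).const_mul _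
  · exact ((S.s_α.mul (S.s_h1.sub S.s_k0)).sub ((S.s_l1.sub S.s_z0).mul S.s_β)).const_mul _
  · exact (((S.s_l1.sub S.s_z0).mul (S.s_h0.add S.s_k1)).add
      ((S.s_l0.add S.s_z1).mul (S.s_k0.sub S.s_h1))).const_mul _

theorem s_adv (i : Fin 3) : IsSpectral (S.adv c i) :=
  IsSpectral.sum _ fun j _ => (S.s_vel c j).mul ((S.s_vel c i).pd j)

theorem s_energy : IsSpectral (S.energy c) :=
  (IsSpectral.sum _ fun j _ => (S.s_vel c j).mul (S.s_vel c j)).const_mul _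

theorem pd_vel0 (j : Fin 3) (x : E3) :
    pd j (S.vel c 0) x = c * (pd j S.k0 x - pd j S.h1 x) := by
  rw [← pd_sub S.s_k0 S.s_h1, ← pd_const_mul (S.s_k0.sub S.s_h1)]; rfl

theorem pd_vel1 (j : Fin 3) (x : E3) :
    pd j (S.vel c 1) x = c * (pd j S.h0 x + pd j S.k1 x) := by
  rw [← pd_add S.s_h0 S.s_k1, ← pd_const_mul (S.s_h0.add S.s_k1)]; rfl

theorem pd_vel2 (j : Fin 3) (x : E3) : pd j (S.vel c 2) x = c * pd j S.β x := by
  rw [← pd_const_mul S.s_β]; rfl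

theorem pd_energy (i : Fin 3) (x : E3) :
    pd i (S.energy c) x = ∑ j, S.vel c j x * pd i (S.vel c j) x := by
  have hs := fun j => S.s_vel c j
  have hm := fun j => (hs j).mul (hs j)
  have e : S.energy c = fun x => (1 / 2) * (S.vel c 0 x * S.vel c 0 x + S.vel c 1 x * S.vel c 1 x
      + S.vel c 2 x * S.vel c 2 x) := by
    ext x; simp only [energy, Fin.sum_univ_three]
  rw [e, pd_const_mul (((hm 0).add (hm 1)).add (hm 2)), pd_add ((hm 0).add (hm 1)) (hm 2),
    pd_add (hm 0) (hm 1), pd_mul (hs 0) (hs 0), pd_mul (hs 1) (hs 1), pd_mul (hs 2) (hs 2),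
    Fin.sum_univ_three]
  ring

/-- The swirl (-h1, h0) is divergence free because h is curl free. The poloidal part is so because
the horizontal divergence of k cancels the vertical derivative of β. -/
theorem div_vel (x : E3) : ∑ j, pd j (S.vel c j) x = 0 := by
  rw [Fin.sum_univ_three, pd_vel0, pd_vel1, pd_vel2, S.pd2_β]
  linear_combination c * S.div_k x - c * S.curl_h x

/-- This is u·∇u = ω × u + ∇|u|²/2. By the relations of the system the vorticity is c (l1 - z0, -(l0
+ z1), -α); the terms β0, β1 cancel because ∂₃k is the horizontal gradient of β minus l. -/
theorem adv_eq_lamb_add (i : Fin 3) (x : E3) :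
    S.adv c i x = S.lamb c i x + pd i (S.energy c) x := by
  have v0 : S.vel c 0 x = c * (S.k0 x - S.h1 x) := rfl
  have v1 : S.vel c 1 x = c * (S.h0 x + S.k1 x) := rfl
  have v2 : S.vel c 2 x = c * S.β x := rfl
  have hh := S.div_h x
  have hk := S.curl_k x
  have hk0 := S.pd_k0 x
  have hk1 := S.pd_k1 x
  rw [pd_energy, adv, Fin.sum_univ_three, Fin.sum_univ_three]
  fin_cases i <;>
  simp only [Fin.zero_eta, Fin.mk_one, Fin.reduceFinMk, pd_vel0, pd_vel1, pd_vel2, v0, v1, v2,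
    S.pd_h0, S.pd_h1, S.pd0_β, S.pd1_β, S.pd2_β, hk0, hk1]
  · change _ = c ^ 2 * (S.α x * (S.h0 x + S.k1 x) - (S.l0 x + S.z1 x) * S.β x) + _
    linear_combination c ^ 2 * (S.h0 x + S.k1 x) * (-hk - hh)
  · change _ = c ^ 2 * (S.α x * (S.h1 x - S.k0 x) - (S.l1 x - S.z0 x) * S.β x) + _
    linear_combination c ^ 2 * (S.k0 x - S.h1 x) * (hk + hh)
  · change _ = c ^ 2 * ((S.l1 x - S.z0 x) * (S.h0 x + S.k1 x)
      + (S.l0 x + S.z1 x) * (S.k0 x - S.h1 x)) + _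
    ring

/-- The divergence form exhibits the pressure as double Riesz transforms of the products u_j u_i,
whose symbols are bounded also at low frequency. -/
theorem adv_eq_div (i : Fin 3) (x : E3) :
    S.adv c i x = ∑ j, pd j (fun y => S.vel c j y * S.vel c i y) x := by
  have hs := fun j => S.s_vel c j
  have hd := S.div_vel c x
  simp only [pd_mul (hs _) (hs i), adv, Finset.sum_add_distrib, ← Finset.sum_mul, hd]
  ring

theorem curl_lamb : ∀ᵐ x : E3, pd 0 (S.lamb c 1) x - pd 1 (S.lamb c 0) x =
    c ^ 2 * ((S.β0 x * S.z0 x + S.β1 x * S.z1 x) - S.β x * S.αz x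
      - (S.k0 x * S.α0 x + S.k1 x * S.α1 x) + S.βz x * S.α x) := by
  filter_upwards [ae_off_axis] with x hx
  -- Once derivatives of h, k, l, z are replaced by scalars, the surplus terms are the cross
  -- products of ∇'α with h and of ∇'β with l, which vanish.
  have w1 := wedge_eq_zero hx (S.radial_α x) (S.radial_h x)
  have w2 := wedge_eq_zero hx (S.radial_β x) (S.radial_l x)
  have e1 : pd 0 (S.lamb c 1) x = c ^ 2 * ((S.α0 x * (S.h1 x - S.k0 x)
      + S.α x * (pd 0 S.h1 x - pd 0 S.k0 x)) - ((pd 0 S.l1 x - pd 0 S.z0 x) * S.β x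
      + (S.l1 x - S.z0 x) * S.β0 x)) := by
    have : S.lamb c 1 = fun x => c ^ 2 * (S.α x * (S.h1 x - S.k0 x) - (S.l1 x - S.z0 x) * S.β x) :=
      rfl
    rw [this, pd_const_mul ((S.s_α.mul (S.s_h1.sub S.s_k0)).sub ((S.s_l1.sub S.s_z0).mul S.s_β)),
      pd_sub (S.s_α.mul (S.s_h1.sub S.s_k0)) ((S.s_l1.sub S.s_z0).mul S.s_β),
      pd_mul S.s_α (S.s_h1.sub S.s_k0), pd_mul (S.s_l1.sub S.s_z0) S.s_β, pd_sub S.s_h1 S.s_k0,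
      pd_sub S.s_l1 S.s_z0, S.pd0_α, S.pd0_β]
  have e2 : pd 1 (S.lamb c 0) x = c ^ 2 * ((S.α1 x * (S.h0 x + S.k1 x)
      + S.α x * (pd 1 S.h0 x + pd 1 S.k1 x)) - ((pd 1 S.l0 x + pd 1 S.z1 x) * S.β x
      + (S.l0 x + S.z1 x) * S.β1 x)) := by
    have : S.lamb c 0 = fun x => c ^ 2 * (S.α x * (S.h0 x + S.k1 x) - (S.l0 x + S.z1 x) * S.β x) :=
      rfl
    rw [this, pd_const_mul ((S.s_α.mul (S.s_h0.add S.s_k1)).sub ((S.s_l0.add S.s_z1).mul S.s_β)),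
      pd_sub (S.s_α.mul (S.s_h0.add S.s_k1)) ((S.s_l0.add S.s_z1).mul S.s_β),
      pd_mul S.s_α (S.s_h0.add S.s_k1), pd_mul (S.s_l0.add S.s_z1) S.s_β, pd_add S.s_h0 S.s_k1,
      pd_add S.s_l0 S.s_z1, S.pd1_α, S.pd1_β]
  rw [e1, e2]
  have t1 := S.curl_h x
  have t2 := S.div_k x
  have t3 := S.curl_l x
  have t4 := S.div_z x
  linear_combination c ^ 2 * (w1 - w2 + S.α x * (t1 - t2) - S.β x * (t3 - t4))

theorem div_lamb : ∀ᵐ x : E3, pd 0 (S.lamb c 0) x + pd 1 (S.lamb c 1) x =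
    c ^ 2 * ((S.h0 x * S.α0 x + S.h1 x * S.α1 x) - S.α x * S.α x
      - (S.β0 x * S.l0 x + S.β1 x * S.l1 x) + S.β x * S.γ x) := by
  filter_upwards [ae_off_axis] with x hx
  -- Here the surplus terms are the cross products of ∇'α with k and of ∇'β with z.
  have w1 := wedge_eq_zero hx (S.radial_α x) (S.radial_k x)
  have w2 := wedge_eq_zero hx (S.radial_β x) (S.radial_z x)
  have e1 : pd 1 (S.lamb c 1) x = c ^ 2 * ((S.α1 x * (S.h1 x - S.k0 x)
      + S.α x * (pd 1 S.h1 x - pd 1 S.k0 x)) - ((pd 1 S.l1 x - pd 1 S.z0 x) * S.β x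
      + (S.l1 x - S.z0 x) * S.β1 x)) := by
    have : S.lamb c 1 = fun x => c ^ 2 * (S.α x * (S.h1 x - S.k0 x) - (S.l1 x - S.z0 x) * S.β x) :=
      rfl
    rw [this, pd_const_mul ((S.s_α.mul (S.s_h1.sub S.s_k0)).sub ((S.s_l1.sub S.s_z0).mul S.s_β)),
      pd_sub (S.s_α.mul (S.s_h1.sub S.s_k0)) ((S.s_l1.sub S.s_z0).mul S.s_β),
      pd_mul S.s_α (S.s_h1.sub S.s_k0), pd_mul (S.s_l1.sub S.s_z0) S.s_β, pd_sub S.s_h1 S.s_k0,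
      pd_sub S.s_l1 S.s_z0, S.pd1_α, S.pd1_β]
  have e2 : pd 0 (S.lamb c 0) x = c ^ 2 * ((S.α0 x * (S.h0 x + S.k1 x)
      + S.α x * (pd 0 S.h0 x + pd 0 S.k1 x)) - ((pd 0 S.l0 x + pd 0 S.z1 x) * S.β x
      + (S.l0 x + S.z1 x) * S.β0 x)) := by
    have : S.lamb c 0 = fun x => c ^ 2 * (S.α x * (S.h0 x + S.k1 x) - (S.l0 x + S.z1 x) * S.β x) :=
      rfl
    rw [this, pd_const_mul ((S.s_α.mul (S.s_h0.add S.s_k1)).sub ((S.s_l0.add S.s_z1).mul S.s_β)),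
      pd_sub (S.s_α.mul (S.s_h0.add S.s_k1)) ((S.s_l0.add S.s_z1).mul S.s_β),
      pd_mul S.s_α (S.s_h0.add S.s_k1), pd_mul (S.s_l0.add S.s_z1) S.s_β, pd_add S.s_h0 S.s_k1,
      pd_add S.s_l0 S.s_z1, S.pd0_α, S.pd0_β]
  rw [e1, e2]
  have t1 := S.curl_k x
  have t2 := S.div_h x
  have t3 := S.curl_z x
  have t4 := S.div_l x
  linear_combination c ^ 2 * (w1 - w2 + S.α x * (t1 + t2) - S.β x * (t3 + t4))

theorem lamb_two : ∀ᵐ x : E3, S.lamb c 2 x =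
    c ^ 2 * ((S.k0 x * S.l0 x + S.k1 x * S.l1 x) - (S.h0 x * S.z0 x + S.h1 x * S.z1 x)) := by
  filter_upwards [ae_off_axis] with x hx
  have w1 := wedge_eq_zero hx (S.radial_h x) (S.radial_l x)
  have w2 := wedge_eq_zero hx (S.radial_k x) (S.radial_z x)
  change c ^ 2 * ((S.l1 x - S.z0 x) * (S.h0 x + S.k1 x)
      + (S.l0 x + S.z1 x) * (S.k0 x - S.h1 x)) = _
  linear_combination c ^ 2 * (w1 + w2)

end FieldSystem

/-! ### Symbols -/

namespace TemperedSymbol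

theorem mul {σ τ : E3 → ℂ} (hσ : TemperedSymbol σ) (hτ : TemperedSymbol τ) :
    TemperedSymbol (σ * τ) := by
  obtain ⟨K, k, h⟩ := hσ.bound
  obtain ⟨K', k', h'⟩ := hτ.bound
  refine ⟨hσ.measurable.mul hτ.measurable, K * K', k + k', fun ξ => ?_⟩
  have hp := jb_pos ξ
  have h0 : 0 ≤ K * jb ξ ^ k := (norm_nonneg _).trans (h ξ)
  rw [Pi.mul_apply, norm_mul]
  calc _ ≤ (K * jb ξ ^ k) * (K' * jb ξ ^ k') := mul_le_mul (h ξ) (h' ξ) (norm_nonneg _) h0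
    _ = _ := by ring

/-- At zeros of τ the inverse is 0 by convention, so the quotient is bounded by 1 everywhere. The
singular factors |ξ'|⁻¹ and |ξ|⁻¹ are handled by pairing each with a numerator it dominates. -/
theorem mul_inv_of_norm_le {σ τ : E3 → ℂ} (hσ : Measurable σ) (hτ : Measurable τ)
    (h : ∀ ξ, ‖σ ξ‖ ≤ ‖τ ξ‖) : TemperedSymbol (σ * τ⁻¹) := by
  refine ⟨hσ.mul hτ.inv, 1, 0, fun ξ => ?_⟩
  rw [Pi.mul_apply, Pi.inv_apply, norm_mul, norm_inv, pow_zero, mul_one]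
  exact div_le_one_of_le₀ (h ξ) (norm_nonneg _)

end TemperedSymbol

theorem horizontalNorm_sq (ξ : E3) : horizontalNorm ξ ^ 2 = ξ 0 ^ 2 + ξ 1 ^ 2 :=
  Real.sq_sqrt (by positivity)

theorem horizontalNorm_nonneg (ξ : E3) : 0 ≤ horizontalNorm ξ := Real.sqrt_nonneg _

theorem norm_sq_eq (ξ : E3) : ‖ξ‖ ^ 2 = ξ 0 ^ 2 + ξ 1 ^ 2 + ξ 2 ^ 2 := by
  rw [EuclideanSpace.norm_sq_eq, Fin.sum_univ_three]
  simp

theorem horizontalNorm_le_norm (ξ : E3) : horizontalNorm ξ ≤ ‖ξ‖ := by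
  refine abs_le_of_sq_le_sq' ?_ (norm_nonneg _) |>.2
  rw [horizontalNorm_sq, norm_sq_eq]
  nlinarith [sq_nonneg (ξ 2)]

theorem norm_symΛ (ξ : E3) : ‖symΛ ξ‖ = 2 * Real.pi * ‖ξ‖ := by
  rw [symΛ, Complex.norm_real, Real.norm_of_nonneg (by positivity)]

theorem norm_symΛh (ξ : E3) : ‖symΛh ξ‖ = 2 * Real.pi * horizontalNorm ξ := by
  have := horizontalNorm_nonneg ξ
  rw [symΛh, Complex.norm_real, Real.norm_of_nonneg (by positivity)]

theorem norm_symD (j : Fin 3) (ξ : E3) : ‖symD j ξ‖ = 2 * Real.pi * |ξ j| := by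
  simp only [symD, norm_mul, Complex.norm_I, mul_one, Complex.norm_real,
    Real.norm_eq_abs, abs_of_pos Real.pi_pos, abs_two]

theorem norm_symD_le (j : Fin 3) (ξ : E3) : ‖symD j ξ‖ ≤ ‖symΛ ξ‖ := by
  rw [norm_symD, norm_symΛ]
  gcongr
  exact PiLp.norm_apply_le ξ j

theorem norm_symD_zero_le (ξ : E3) : ‖symD 0 ξ‖ ≤ ‖symΛh ξ‖ := by
  rw [norm_symD, norm_symΛh]
  gcongr
  refine abs_le_of_sq_le_sq ?_ (horizontalNorm_nonneg ξ)
  rw [horizontalNorm_sq]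
  nlinarith [sq_nonneg (ξ 1)]

theorem norm_symD_one_le (ξ : E3) : ‖symD 1 ξ‖ ≤ ‖symΛh ξ‖ := by
  rw [norm_symD, norm_symΛh]
  gcongr
  refine abs_le_of_sq_le_sq ?_ (horizontalNorm_nonneg ξ)
  rw [horizontalNorm_sq]
  nlinarith [sq_nonneg (ξ 0)]

theorem norm_symΛh_le (ξ : E3) : ‖symΛh ξ‖ ≤ ‖symΛ ξ‖ := by
  rw [norm_symΛh, norm_symΛ]
  gcongr
  exact horizontalNorm_le_norm ξ

theorem measurable_symΛ : Measurable symΛ := by unfold symΛ; fun_prop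

theorem measurable_symΛh : Measurable symΛh := by unfold symΛh horizontalNorm; fun_prop

theorem measurable_symD (j : Fin 3) : Measurable (symD j) := (temperedSymbol_symD j).measurable

theorem temperedSymbol_symΛ : TemperedSymbol symΛ := by
  refine ⟨measurable_symΛ, 2 * Real.pi, 1, fun ξ => ?_⟩
  rw [norm_symΛ, pow_one]
  gcongr
  exact norm_le_jb ξ

theorem temperedSymbol_symΛh : TemperedSymbol symΛh := by
  obtain ⟨K, k, h⟩ := temperedSymbol_symΛ.bound
  exact ⟨measurable_symΛh, K, k, fun ξ => (norm_symΛh_le ξ).trans (h ξ)⟩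

theorem temperedSymbol_symD_zero_mul_inv : TemperedSymbol (symD 0 * symΛh⁻¹) :=
  .mul_inv_of_norm_le (measurable_symD 0) measurable_symΛh norm_symD_zero_le

theorem temperedSymbol_symD_one_mul_inv : TemperedSymbol (symD 1 * symΛh⁻¹) :=
  .mul_inv_of_norm_le (measurable_symD 1) measurable_symΛh norm_symD_one_le

theorem temperedSymbol_symD_mul_inv (j : Fin 3) : TemperedSymbol (symD j * symΛ⁻¹) :=
  .mul_inv_of_norm_le (measurable_symD j) measurable_symΛ (norm_symD_le j)

theorem temperedSymbol_symΛh_mul_inv : TemperedSymbol (symΛh * symΛ⁻¹) :=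
  .mul_inv_of_norm_le measurable_symΛh measurable_symΛ norm_symΛh_le

theorem symD_sq_add (ξ : E3) : symD 0 ξ ^ 2 + symD 1 ξ ^ 2 = -symΛh ξ ^ 2 := by
  have h : (horizontalNorm ξ : ℂ) ^ 2 = (ξ 0 : ℂ) ^ 2 + (ξ 1 : ℂ) ^ 2 := by
    exact_mod_cast horizontalNorm_sq ξ
  simp only [symD, symΛh]
  push_cast
  linear_combination (4 * (Real.pi : ℂ) ^ 2 * ((ξ 0 : ℂ) ^ 2 + (ξ 1 : ℂ) ^ 2)) * Complex.I_sq
    - 4 * (Real.pi : ℂ) ^ 2 * -h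

theorem symΛ_sq (ξ : E3) : symΛ ξ ^ 2 = symΛh ξ ^ 2 - symD 2 ξ ^ 2 := by
  have h : (horizontalNorm ξ : ℂ) ^ 2 = (ξ 0 : ℂ) ^ 2 + (ξ 1 : ℂ) ^ 2 := by
    exact_mod_cast horizontalNorm_sq ξ
  have h' : ((‖ξ‖ : ℝ) : ℂ) ^ 2 = (ξ 0 : ℂ) ^ 2 + (ξ 1 : ℂ) ^ 2 + (ξ 2 : ℂ) ^ 2 := by
    exact_mod_cast norm_sq_eq ξ
  simp only [symD, symΛh, symΛ]
  push_cast
  linear_combination 4 * (Real.pi : ℂ) ^ 2 * (h' - h + (ξ 2 : ℂ) ^ 2 * Complex.I_sq)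

theorem symΛh_ne_zero {ξ : E3} (h : ξ 0 ≠ 0) : symΛh ξ ≠ 0 := by
  have h1 : 0 < horizontalNorm ξ := Real.sqrt_pos.2 (by positivity)
  rw [← norm_pos_iff, norm_symΛh]
  positivity

theorem symΛ_ne_zero {ξ : E3} (h : ξ 0 ≠ 0) : symΛ ξ ≠ 0 := by
  rw [← norm_pos_iff]
  exact (norm_pos_iff.2 (symΛh_ne_zero h)).trans_le (norm_symΛh_le ξ)

theorem horizontalNorm_neg (ξ : E3) : horizontalNorm (-ξ) = horizontalNorm ξ := by
  simp [horizontalNorm]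

theorem symΛ_neg (ξ : E3) : symΛ (-ξ) = symΛ ξ := by simp [symΛ]

theorem symΛh_neg (ξ : E3) : symΛh (-ξ) = symΛh ξ := by simp [symΛh, horizontalNorm_neg]

theorem symD_neg (j : Fin 3) (ξ : E3) : symD j (-ξ) = -symD j ξ := by simp [symD]

/-! ### Axial symmetry -/

/-- A linear isometry that preserves the distance to the axis and the height. -/
def IsAxial (A : E3 ≃ₗᵢ[ℝ] E3) : Prop :=
  ∀ ξ, horizontalNorm (A ξ) = horizontalNorm ξ ∧ (A ξ) 2 = ξ 2

/-- Invariance of a symbol under the isometries that fix the axis. -/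
def AxialSymbol (σ : E3 → ℂ) : Prop := ∀ A, IsAxial A → ∀ ξ, σ (A ξ) = σ ξ

/-- Invariance almost everywhere under the isometries that fix the axis. -/
def AxialSpectrum (g : E3 → ℂ) : Prop := ∀ A, IsAxial A → (fun ξ => g (A ξ)) =ᵐ[volume] g

theorem AxialSymbol.mul {σ τ : E3 → ℂ} (hσ : AxialSymbol σ) (hτ : AxialSymbol τ) :
    AxialSymbol (σ * τ) := fun A hA ξ => by
  rw [Pi.mul_apply, Pi.mul_apply, hσ A hA, hτ A hA]

theorem AxialSymbol.inv {σ : E3 → ℂ} (hσ : AxialSymbol σ) : AxialSymbol σ⁻¹ := fun A hA ξ => by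
  rw [Pi.inv_apply, Pi.inv_apply, hσ A hA]

theorem axialSymbol_symΛ : AxialSymbol symΛ := fun A _ ξ => by simp [symΛ]

theorem axialSymbol_symΛh : AxialSymbol symΛh := fun A hA ξ => by simp [symΛh, (hA ξ).1]

theorem axialSymbol_symD_two : AxialSymbol (symD 2) := fun A hA ξ => by simp [symD, (hA ξ).2]

theorem axialSpectrum_of_isAxisymmetric {f : E3 → ℝ} (hf : IsAxisymmetric f) {g : E3 → ℂ}
    (h : HasSpectrum (fun x => (f x : ℂ)) g) : AxialSpectrum g := fun A hA => by
  refine (h.comp_isometry A).ae_unique h (Eventually.of_forall fun x => ?_)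
  simp only [hf (A x) x (hA x).1 (hA x).2]

/-- The horizontal vector orthogonal to the position. -/
noncomputable def angularVector (x : E3) : E3 := !₂[-x 1, x 0, 0]

/-- The reflection in the plane spanned by the axis and `x`. -/
noncomputable def axialReflection (x : E3) : E3 ≃ₗᵢ[ℝ] E3 :=
  (ℝ ∙ angularVector x)ᗮ.reflection

theorem inner_angularVector (x y : E3) :
    inner ℝ (angularVector x) y = x 0 * y 1 - x 1 * y 0 := by
  rw [PiLp.inner_apply, Fin.sum_univ_three]
  simp [angularVector]
  ring

theorem axialReflection_self (x : E3) : axialReflection x x = x := by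
  rw [axialReflection, Submodule.reflection_eq_self_iff, Submodule.mem_orthogonal_singleton_iff_inner_right,
    inner_angularVector]
  ring

theorem inner_angularVector_axialReflection (x y : E3) :
    inner ℝ (angularVector x) (axialReflection x y) = -inner ℝ (angularVector x) y := by
  have h : axialReflection x (angularVector x) = -angularVector x :=
    Submodule.reflection_orthogonalComplement_singleton_eq_neg _
  have h2 := (axialReflection x).inner_map_map (angularVector x) y
  rw [h, inner_neg_left] at h2
  linarith

/-- The vertical direction is orthogonal to the angular vector, hence fixed. Height and total norm
are preserved, and with them the distance to the axis. -/
theorem isAxial_axialReflection (x : E3) : IsAxial (axialReflection x) := by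
  intro ξ
  have h2 : (axialReflection x ξ) 2 = ξ 2 := by
    have h3 : axialReflection x (EuclideanSpace.single 2 1) = EuclideanSpace.single 2 1 := by
      rw [axialReflection, Submodule.reflection_eq_self_iff,
        Submodule.mem_orthogonal_singleton_iff_inner_right, inner_angularVector]
      simp
    have h4 := (axialReflection x).inner_map_map (EuclideanSpace.single 2 1) ξ
    rw [h3, EuclideanSpace.inner_single_left, EuclideanSpace.inner_single_left] at h4
    simpa using h4
  refine ⟨?_, h2⟩
  have h5 : ‖axialReflection x ξ‖ ^ 2 = ‖ξ‖ ^ 2 := by rw [LinearIsometryEquiv.norm_map]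
  rw [norm_sq_eq, norm_sq_eq, h2] at h5
  rw [horizontalNorm, horizontalNorm]
  congr 1
  linarith

/-! ### Multiplier fields -/

/-- The Fourier multiplier `σ` applied to the function with spectrum `g`. -/
noncomputable def field (σ g : E3 → ℂ) : E3 → ℂ := 𝓕⁻ fun ξ => σ ξ * g ξ

theorem hasSpectrum_field {σ g : E3 → ℂ} (hσ : TemperedSymbol σ) (hg : RapidL2 g) :
    HasSpectrum (field σ g) fun ξ => σ ξ * g ξ := (hg.symbol_mul hσ).hasSpectrum

theorem isSpectral_field {σ g : E3 → ℂ} (hσ : TemperedSymbol σ) (hg : RapidL2 g) :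
    IsSpectral (field σ g) := ⟨_, hasSpectrum_field hσ hg⟩

theorem pd_field {σ τ g : E3 → ℂ} (hσ : TemperedSymbol σ) (hg : RapidL2 g) (j : Fin 3)
    (h : ∀ ξ, ξ 0 ≠ 0 → symD j ξ * σ ξ = τ ξ) : pd j (field σ g) = field τ g := by
  have h1 := (hasSpectrum_field hσ hg).pd j
  refine (h1.congr_spectrum ?_).eq
  filter_upwards [ae_coord_zero_ne_zero] with ξ hξ
  rw [← h ξ hξ, mul_assoc]

theorem field_add_field {σ τ ρ g : E3 → ℂ} (hσ : TemperedSymbol σ) (hτ : TemperedSymbol τ)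
    (hg : RapidL2 g) (h : ∀ ξ, ξ 0 ≠ 0 → σ ξ + τ ξ = ρ ξ) (x : E3) :
    field σ g x + field τ g x = field ρ g x := by
  have h1 := (hasSpectrum_field hσ hg).add (hasSpectrum_field hτ hg)
  refine congrFun (h1.congr_spectrum ?_).eq x
  filter_upwards [ae_coord_zero_ne_zero] with ξ hξ
  rw [← h ξ hξ, add_mul]

theorem field_neg {σ g : E3 → ℂ} (hσ : TemperedSymbol σ) (hg : RapidL2 g) (x : E3) :
    field (-σ) g x = -field σ g x := by
  refine congrFun ((hasSpectrum_field hσ hg).neg.congr_spectrum ?_).eq.symm x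
  exact Eventually.of_forall fun ξ => by simp

/-- The angular component in the direction fixed by x has as spectrum an axially invariant function
times the pairing of ξ with the angular vector. The reflection in the plane through the axis and x
changes its sign but fixes x, so the component vanishes at x. -/
theorem field_radial {σ g : E3 → ℂ} (hg : RapidL2 g) (hgx : AxialSpectrum g)
    (hσ : AxialSymbol σ) (h0 : TemperedSymbol (symD 0 * σ)) (h1 : TemperedSymbol (symD 1 * σ))
    (x : E3) : (x 0 : ℂ) * field (symD 1 * σ) g x = x 1 * field (symD 0 * σ) g x := by
  have e := ((hasSpectrum_field h1 hg).const_mul (x 0)).sub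
    ((hasSpectrum_field h0 hg).const_mul (x 1))
  have e' := e.comp_isometry (axialReflection x)
  have hval : ∀ ξ, (x 0 : ℂ) * ((symD 1 * σ) ξ * g ξ) - x 1 * ((symD 0 * σ) ξ * g ξ) =
      ((inner ℝ (angularVector x) ξ : ℝ) : ℂ) * (2 * Real.pi * Complex.I * σ ξ * g ξ) := by
    intro ξ
    rw [inner_angularVector]
    simp only [Pi.mul_apply, symD]
    push_cast
    ring
  have h := congrFun (e'.eq_of_ae_eq e.neg ?_) x
  · rw [axialReflection_self] at h
    have h' : (x 0 : ℂ) * field (symD 1 * σ) g x - x 1 * field (symD 0 * σ) g x = 0 :=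
      self_eq_neg.1 h
    exact sub_eq_zero.1 h'
  · filter_upwards [hgx _ (isAxial_axialReflection x)] with ξ hξ
    rw [hval, hval, hξ, inner_angularVector_axialReflection, hσ _ (isAxial_axialReflection x)]
    push_cast
    ring

/-! ### The field system of an axisymmetric spectrum -/

/-- Twice the even part. -/
def evenSum (g : E3 → ℂ) (ξ : E3) : ℂ := g ξ + g (-ξ)

/-- Twice the odd part. -/
def oddSum (g : E3 → ℂ) (ξ : E3) : ℂ := g ξ - g (-ξ)

theorem ae_comp_neg {P : E3 → Prop} (h : ∀ᵐ ξ : E3, P ξ) : ∀ᵐ ξ : E3, P (-ξ) :=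
  (Measure.measurePreserving_neg (volume : Measure E3)).quasiMeasurePreserving.ae h

theorem RapidL2.evenSum {g : E3 → ℂ} (hg : RapidL2 g) : RapidL2 (evenSum g) :=
  hg.add (hg.comp_isometry (LinearIsometryEquiv.neg ℝ))

theorem RapidL2.oddSum {g : E3 → ℂ} (hg : RapidL2 g) : RapidL2 (oddSum g) :=
  hg.sub (hg.comp_isometry (LinearIsometryEquiv.neg ℝ))

theorem AxialSpectrum.evenSum {g : E3 → ℂ} (hg : AxialSpectrum g) : AxialSpectrum (evenSum g) := by
  intro A hA
  filter_upwards [hg A hA, ae_comp_neg (hg A hA)] with ξ h1 h2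
  rw [map_neg] at h2
  rw [_root_.evenSum, _root_.evenSum, h1, h2]

theorem AxialSpectrum.oddSum {g : E3 → ℂ} (hg : AxialSpectrum g) : AxialSpectrum (oddSum g) := by
  intro A hA
  filter_upwards [hg A hA, ae_comp_neg (hg A hA)] with ξ h1 h2
  rw [map_neg] at h2
  rw [_root_.oddSum, _root_.oddSum, h1, h2]

theorem tempered_z0 : TemperedSymbol (symD 0 * (symΛh⁻¹ * symD 2)) := by
  rw [← mul_assoc]; exact temperedSymbol_symD_zero_mul_inv.mul (temperedSymbol_symD 2)

theorem tempered_z1 : TemperedSymbol (symD 1 * (symΛh⁻¹ * symD 2)) := by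
  rw [← mul_assoc]; exact temperedSymbol_symD_one_mul_inv.mul (temperedSymbol_symD 2)

theorem tempered_k0 : TemperedSymbol (symD 0 * (symΛh⁻¹ * symΛ⁻¹ * symD 2)) := by
  have e : symD 0 * (symΛh⁻¹ * symΛ⁻¹ * symD 2) = (symD 0 * symΛh⁻¹) * (symD 2 * symΛ⁻¹) := by ring
  rw [e]; exact temperedSymbol_symD_zero_mul_inv.mul (temperedSymbol_symD_mul_inv 2)

theorem tempered_k1 : TemperedSymbol (symD 1 * (symΛh⁻¹ * symΛ⁻¹ * symD 2)) := by
  have e : symD 1 * (symΛh⁻¹ * symΛ⁻¹ * symD 2) = (symD 1 * symΛh⁻¹) * (symD 2 * symΛ⁻¹) := by ring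
  rw [e]; exact temperedSymbol_symD_one_mul_inv.mul (temperedSymbol_symD_mul_inv 2)

theorem tempered_l0 : TemperedSymbol (symD 0 * (symΛ * symΛh⁻¹)) := by
  have e : symD 0 * (symΛ * symΛh⁻¹) = (symD 0 * symΛh⁻¹) * symΛ := by ring
  rw [e]; exact temperedSymbol_symD_zero_mul_inv.mul temperedSymbol_symΛ

theorem tempered_l1 : TemperedSymbol (symD 1 * (symΛ * symΛh⁻¹)) := by
  have e : symD 1 * (symΛ * symΛh⁻¹) = (symD 1 * symΛh⁻¹) * symΛ := by ring
  rw [e]; exact temperedSymbol_symD_one_mul_inv.mul temperedSymbol_symΛ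

theorem sub_field_eq {σ τ ρ g : E3 → ℂ} (hσ : TemperedSymbol σ) (hτ : TemperedSymbol τ)
    (hg : RapidL2 g) (h : ∀ ξ, ξ 0 ≠ 0 → ρ ξ = σ ξ - τ ξ) (x : E3) :
    field ρ g x = field σ g x - field τ g x := by
  have h1 := (hasSpectrum_field hσ hg).sub (hasSpectrum_field hτ hg)
  refine (congrFun (h1.congr_spectrum ?_).eq x).symm
  filter_upwards [ae_coord_zero_ne_zero] with ξ hξ
  rw [h ξ hξ, sub_mul]

theorem field_add_eq_neg {σ τ ρ g : E3 → ℂ} (hσ : TemperedSymbol σ) (hτ : TemperedSymbol τ)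
    (hρ : TemperedSymbol ρ) (hg : RapidL2 g) (h : ∀ ξ, ξ 0 ≠ 0 → σ ξ + τ ξ = -ρ ξ) (x : E3) :
    field σ g x + field τ g x = -field ρ g x := by
  rw [← field_neg hρ hg]
  exact field_add_field hσ hτ hg h x

section

variable {g : E3 → ℂ}

theorem curl_field_eq {σ : E3 → ℂ} (hg : RapidL2 g) (h0 : TemperedSymbol (symD 0 * σ))
    (h1 : TemperedSymbol (symD 1 * σ)) (x : E3) :
    pd 0 (field (symD 1 * σ) g) x = pd 1 (field (symD 0 * σ) g) x := by
  rw [pd_field (τ := symD 1 * (symD 0 * σ)) h0 hg 1 fun _ _ => rfl,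
    pd_field (τ := symD 1 * (symD 0 * σ)) h1 hg 0 fun ξ _ => by simp only [Pi.mul_apply]; ring]

theorem div_field_eq {σ τ : E3 → ℂ} (hg : RapidL2 g) (h0 : TemperedSymbol (symD 0 * σ))
    (h1 : TemperedSymbol (symD 1 * σ)) (hτ : TemperedSymbol τ)
    (h : ∀ ξ, ξ 0 ≠ 0 → symΛh ξ ^ 2 * σ ξ = τ ξ) (x : E3) :
    pd 0 (field (symD 0 * σ) g) x + pd 1 (field (symD 1 * σ) g) x = -field τ g x := by
  rw [pd_field (τ := symD 0 * (symD 0 * σ)) h0 hg 0 fun _ _ => rfl,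
    pd_field (τ := symD 1 * (symD 1 * σ)) h1 hg 1 fun _ _ => rfl]
  refine field_add_eq_neg ((temperedSymbol_symD 0).mul h0) ((temperedSymbol_symD 1).mul h1) hτ hg
    (fun ξ hξ => ?_) x
  rw [← h ξ hξ]
  simp only [Pi.mul_apply]
  linear_combination σ ξ * symD_sq_add ξ

end

/-- The fields of the flow generated by the axisymmetric spectrum `g`. -/
noncomputable def fieldsOf (g : E3 → ℂ) (hg : RapidL2 g) (hx : AxialSpectrum g) : FieldSystem where
  h0 := field (symD 0 * symΛh⁻¹) (evenSum g)
  h1 := field (symD 1 * symΛh⁻¹) (evenSum g)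
  z0 := field (symD 0 * (symΛh⁻¹ * symD 2)) (evenSum g)
  z1 := field (symD 1 * (symΛh⁻¹ * symD 2)) (evenSum g)
  k0 := field (symD 0 * (symΛh⁻¹ * symΛ⁻¹ * symD 2)) (oddSum g)
  k1 := field (symD 1 * (symΛh⁻¹ * symΛ⁻¹ * symD 2)) (oddSum g)
  l0 := field (symD 0 * (symΛ * symΛh⁻¹)) (oddSum g)
  l1 := field (symD 1 * (symΛ * symΛh⁻¹)) (oddSum g)
  α := field symΛh (evenSum g)
  α0 := field (symD 0 * symΛh) (evenSum g)
  α1 := field (symD 1 * symΛh) (evenSum g)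
  αz := field (symΛh * symD 2) (evenSum g)
  β := field (symΛh * symΛ⁻¹) (oddSum g)
  β0 := field (symD 0 * (symΛh * symΛ⁻¹)) (oddSum g)
  β1 := field (symD 1 * (symΛh * symΛ⁻¹)) (oddSum g)
  βz := field (symΛh * symΛ⁻¹ * symD 2) (oddSum g)
  γ := field (symΛ * symΛh) (oddSum g)
  s_h0 := isSpectral_field temperedSymbol_symD_zero_mul_inv hg.evenSum
  s_h1 := isSpectral_field temperedSymbol_symD_one_mul_inv hg.evenSum
  s_k0 := isSpectral_field tempered_k0 hg.oddSum
  s_k1 := isSpectral_field tempered_k1 hg.oddSum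
  s_l0 := isSpectral_field tempered_l0 hg.oddSum
  s_l1 := isSpectral_field tempered_l1 hg.oddSum
  s_α := isSpectral_field temperedSymbol_symΛh hg.evenSum
  s_β := isSpectral_field temperedSymbol_symΛh_mul_inv hg.oddSum
  s_γ := isSpectral_field (temperedSymbol_symΛ.mul temperedSymbol_symΛh) hg.oddSum
  curl_h := curl_field_eq hg.evenSum temperedSymbol_symD_zero_mul_inv
    temperedSymbol_symD_one_mul_inv
  div_h := div_field_eq hg.evenSum temperedSymbol_symD_zero_mul_inv
    temperedSymbol_symD_one_mul_inv temperedSymbol_symΛh fun ξ hξ => by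
      have := symΛh_ne_zero hξ
      simp only [Pi.inv_apply]; field_simp
  pd_h0 := pd_field temperedSymbol_symD_zero_mul_inv hg.evenSum 2 fun ξ _ => by
    simp only [Pi.mul_apply]; ring
  pd_h1 := pd_field temperedSymbol_symD_one_mul_inv hg.evenSum 2 fun ξ _ => by
    simp only [Pi.mul_apply]; ring
  curl_z := curl_field_eq hg.evenSum tempered_z0 tempered_z1
  div_z := div_field_eq hg.evenSum tempered_z0 tempered_z1
    (temperedSymbol_symΛh.mul (temperedSymbol_symD 2)) fun ξ hξ => by
      have := symΛh_ne_zero hξ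
      simp only [Pi.mul_apply, Pi.inv_apply]; field_simp
  curl_k := curl_field_eq hg.oddSum tempered_k0 tempered_k1
  div_k := div_field_eq hg.oddSum tempered_k0 tempered_k1
    (temperedSymbol_symΛh_mul_inv.mul (temperedSymbol_symD 2)) fun ξ hξ => by
      have := symΛh_ne_zero hξ
      simp only [Pi.mul_apply, Pi.inv_apply]; field_simp
  pd_k0 := fun x => by
    rw [pd_field (τ := symD 2 * (symD 0 * (symΛh⁻¹ * symΛ⁻¹ * symD 2))) tempered_k0 hg.oddSum 2
      fun _ _ => rfl]
    refine sub_field_eq ((temperedSymbol_symD 0).mul temperedSymbol_symΛh_mul_inv) tempered_l0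
      hg.oddSum (fun ξ hξ => ?_) x
    have h1 := symΛh_ne_zero hξ
    have h2 := symΛ_ne_zero hξ
    simp only [Pi.mul_apply, Pi.inv_apply]
    field_simp
    -- The relation ∂₃² = Λ'² - Λ² between the symbols turns ∂₃² (Λ' Λ)⁻¹ into Λ' Λ⁻¹ - Λ Λ'⁻¹.
    linear_combination symD 0 ξ * symΛ_sq ξ
  pd_k1 := fun x => by
    rw [pd_field (τ := symD 2 * (symD 1 * (symΛh⁻¹ * symΛ⁻¹ * symD 2))) tempered_k1 hg.oddSum 2
      fun _ _ => rfl]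
    refine sub_field_eq ((temperedSymbol_symD 1).mul temperedSymbol_symΛh_mul_inv) tempered_l1
      hg.oddSum (fun ξ hξ => ?_) x
    have h1 := symΛh_ne_zero hξ
    have h2 := symΛ_ne_zero hξ
    simp only [Pi.mul_apply, Pi.inv_apply]
    field_simp
    linear_combination symD 1 ξ * symΛ_sq ξ
  curl_l := curl_field_eq hg.oddSum tempered_l0 tempered_l1
  div_l := div_field_eq hg.oddSum tempered_l0 tempered_l1
    (temperedSymbol_symΛ.mul temperedSymbol_symΛh) fun ξ hξ => by
      have := symΛh_ne_zero hξ
      simp only [Pi.mul_apply, Pi.inv_apply]; field_simp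
  pd0_α := pd_field temperedSymbol_symΛh hg.evenSum 0 fun _ _ => rfl
  pd1_α := pd_field temperedSymbol_symΛh hg.evenSum 1 fun _ _ => rfl
  pd2_α := pd_field temperedSymbol_symΛh hg.evenSum 2 fun _ _ => mul_comm _ _
  pd0_β := pd_field temperedSymbol_symΛh_mul_inv hg.oddSum 0 fun _ _ => rfl
  pd1_β := pd_field temperedSymbol_symΛh_mul_inv hg.oddSum 1 fun _ _ => rfl
  pd2_β := pd_field temperedSymbol_symΛh_mul_inv hg.oddSum 2 fun _ _ => mul_comm _ _
  radial_h := field_radial hg.evenSum hx.evenSum axialSymbol_symΛh.inv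
    temperedSymbol_symD_zero_mul_inv temperedSymbol_symD_one_mul_inv
  radial_z := field_radial hg.evenSum hx.evenSum (axialSymbol_symΛh.inv.mul axialSymbol_symD_two)
    tempered_z0 tempered_z1
  radial_k := field_radial hg.oddSum hx.oddSum
    ((axialSymbol_symΛh.inv.mul axialSymbol_symΛ.inv).mul axialSymbol_symD_two)
    tempered_k0 tempered_k1
  radial_l := field_radial hg.oddSum hx.oddSum (axialSymbol_symΛ.mul axialSymbol_symΛh.inv)
    tempered_l0 tempered_l1
  radial_α := field_radial hg.evenSum hx.evenSum axialSymbol_symΛh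
    ((temperedSymbol_symD 0).mul temperedSymbol_symΛh)
    ((temperedSymbol_symD 1).mul temperedSymbol_symΛh)
  radial_β := field_radial hg.oddSum hx.oddSum (axialSymbol_symΛh.mul axialSymbol_symΛ.inv)
    ((temperedSymbol_symD 0).mul temperedSymbol_symΛh_mul_inv)
    ((temperedSymbol_symD 1).mul temperedSymbol_symΛh_mul_inv)

/-! ### Radial derivatives -/

/-- The product of two horizontal vector fields. -/
def hdot (f0 f1 g0 g1 : E3 → ℂ) (x : E3) : ℂ := f0 x * g0 x + f1 x * g1 x

/-- For horizontal fields parallel to (x₁, x₂) the dot product is the product of the radial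
components. -/
theorem radialDeriv_mul_ae_eq {f f' σ σ' F0 F1 G0 G1 : E3 → ℂ}
    (h0 : multiplier (symD 0 * σ) f =ᵐ[volume] F0) (h1 : multiplier (symD 1 * σ) f =ᵐ[volume] F1)
    (h0' : multiplier (symD 0 * σ') f' =ᵐ[volume] G0)
    (h1' : multiplier (symD 1 * σ') f' =ᵐ[volume] G1)
    (hF : ∀ x, (x 0 : ℂ) * F1 x = x 1 * F0 x) (hG : ∀ x, (x 0 : ℂ) * G1 x = x 1 * G0 x) :
    (fun x => radialDeriv σ f x * radialDeriv σ' f' x) =ᵐ[volume] hdot F0 F1 G0 G1 := by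
  filter_upwards [h0, h1, h0', h1', ae_coord_zero_ne_zero] with x e0 e1 e0' e1' hx
  have hr : (horizontalNorm x : ℂ) ≠ 0 :=
    Complex.ofReal_ne_zero.2 (Real.sqrt_pos.2 (by positivity)).ne'
  have hr2 : (horizontalNorm x : ℂ) ^ 2 = (x 0 : ℂ) ^ 2 + (x 1 : ℂ) ^ 2 := by
    exact_mod_cast horizontalNorm_sq x
  have hx' : (x 0 : ℂ) ≠ 0 := Complex.ofReal_ne_zero.2 hx
  have e2 : F1 x = x 1 * F0 x / x 0 := by rw [← hF x]; field_simp
  have e3 : G1 x = x 1 * G0 x / x 0 := by rw [← hG x]; field_simp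
  simp only [radialDeriv, hdot, e0, e1, e0', e1', e2, e3]
  push_cast
  field_simp
  rw [hr2]
  ring

/-! ### The quadratic forcing -/

theorem IsSpectral.hdot {f0 f1 g0 g1 : E3 → ℂ} (hf0 : IsSpectral f0) (hf1 : IsSpectral f1)
    (hg0 : IsSpectral g0) (hg1 : IsSpectral g1) : IsSpectral (hdot f0 f1 g0 g1) :=
  (hf0.mul hg0).add (hf1.mul hg1)

theorem IsSpectral.hasSpectrum_fourier {f : E3 → ℂ} (h : IsSpectral f)
    (hi : Integrable f volume) : HasSpectrum f (𝓕 f) :=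
  h.hasSpectrum.congr_spectrum (l2Fourier_eq_fourier hi h.memLp)

theorem hasSpectrum_hdot {f0 f1 g0 g1 : E3 → ℂ} (hf0 : IsSpectral f0) (hf1 : IsSpectral f1)
    (hg0 : IsSpectral g0) (hg1 : IsSpectral g1) :
    HasSpectrum (hdot f0 f1 g0 g1) (𝓕 (hdot f0 f1 g0 g1)) :=
  (hf0.hdot hf1 hg0 hg1).hasSpectrum_fourier
    ((hf0.integrable_mul hg0).add (hf1.integrable_mul hg1))

theorem hasSpectrum_mul {f g : E3 → ℂ} (hf : IsSpectral f) (hg : IsSpectral g) :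
    HasSpectrum (fun x => f x * g x) (𝓕 fun x => f x * g x) :=
  hf.hasSpectrum.mul hg.hasSpectrum

namespace FieldSystem

variable (S : FieldSystem)

/-- The transform of the forcing of the swirl component. -/
noncomputable def swirlForce (ξ : E3) : ℂ :=
  𝓕 (hdot S.β0 S.β1 S.z0 S.z1) ξ - 𝓕 (fun x => S.β x * S.αz x) ξ
    - 𝓕 (hdot S.k0 S.k1 S.α0 S.α1) ξ + 𝓕 (fun x => S.βz x * S.α x) ξ

/-- The transform of the vertical forcing of the poloidal component. -/
noncomputable def verticalForce (ξ : E3) : ℂ :=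
  𝓕 (hdot S.h0 S.h1 S.z0 S.z1) ξ - 𝓕 (hdot S.k0 S.k1 S.l0 S.l1) ξ

/-- The transform of the divergence of the horizontal forcing of the poloidal component. -/
noncomputable def horizontalForce (ξ : E3) : ℂ :=
  𝓕 (hdot S.β0 S.β1 S.l0 S.l1) ξ - 𝓕 (fun x => S.β x * S.γ x) ξ
    - 𝓕 (hdot S.h0 S.h1 S.α0 S.α1) ξ + 𝓕 (fun x => S.α x * S.α x) ξ

variable (c : ℂ)

theorem spectrum_curl_lamb : (fun ξ => symD 0 ξ * l2Fourier (S.lamb c 1) ξ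
    - symD 1 ξ * l2Fourier (S.lamb c 0) ξ) =ᵐ[volume] fun ξ => c ^ 2 * S.swirlForce ξ := by
  have h1 := ((S.s_lamb c 1).hasSpectrum.pd 0).sub ((S.s_lamb c 0).hasSpectrum.pd 1)
  have h2 := ((((hasSpectrum_hdot S.s_β0 S.s_β1 S.s_z0 S.s_z1).sub
    (hasSpectrum_mul S.s_β S.s_αz)).sub (hasSpectrum_hdot S.s_k0 S.s_k1 S.s_α0 S.s_α1)).add
    (hasSpectrum_mul S.s_βz S.s_α)).const_mul (c ^ 2)
  exact h1.ae_unique h2 (S.curl_lamb c)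

theorem spectrum_div_lamb : (fun ξ => symD 0 ξ * l2Fourier (S.lamb c 0) ξ
    + symD 1 ξ * l2Fourier (S.lamb c 1) ξ) =ᵐ[volume] fun ξ => -c ^ 2 * S.horizontalForce ξ := by
  have h1 := ((S.s_lamb c 0).hasSpectrum.pd 0).add ((S.s_lamb c 1).hasSpectrum.pd 1)
  have h2 := ((((hasSpectrum_hdot S.s_β0 S.s_β1 S.s_l0 S.s_l1).sub
    (hasSpectrum_mul S.s_β S.s_γ)).sub (hasSpectrum_hdot S.s_h0 S.s_h1 S.s_α0 S.s_α1)).add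
    (hasSpectrum_mul S.s_α S.s_α)).const_mul (-c ^ 2)
  refine h1.ae_unique h2 ?_
  filter_upwards [S.div_lamb c] with x hx
  rw [hx]
  simp only [hdot]
  ring

theorem spectrum_lamb_two :
    l2Fourier (S.lamb c 2) =ᵐ[volume] fun ξ => -c ^ 2 * S.verticalForce ξ := by
  have h2 := ((hasSpectrum_hdot S.s_h0 S.s_h1 S.s_z0 S.s_z1).sub
    (hasSpectrum_hdot S.s_k0 S.s_k1 S.s_l0 S.s_l1)).const_mul (-c ^ 2)
  refine (S.s_lamb c 2).hasSpectrum.ae_unique h2 ?_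
  filter_upwards [S.lamb_two c] with x hx
  rw [hx]
  simp only [hdot]
  ring

/-- The transform of the pressure. -/
noncomputable def pressureSpectrum (ξ : E3) : ℂ :=
  ∑ i, ∑ j, ((symD i * symΛ⁻¹) * (symD j * symΛ⁻¹)) ξ *
    l2Fourier (fun x => S.vel c j x * S.vel c i x) ξ

theorem rapidL2_pressureSpectrum : RapidL2 (S.pressureSpectrum c) :=
  (HasSpectrum.sum Finset.univ fun i _ => HasSpectrum.sum Finset.univ fun j _ =>
    hasSpectrum_field ((temperedSymbol_symD_mul_inv i).mul (temperedSymbol_symD_mul_inv j))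
      ((S.s_vel c j).mul (S.s_vel c i)).hasSpectrum.rapid).rapid

theorem spectrum_adv (i : Fin 3) : l2Fourier (S.adv c i) =ᵐ[volume] fun ξ =>
    l2Fourier (S.lamb c i) ξ + symD i ξ * l2Fourier (S.energy c) ξ :=
  (S.s_adv c i).hasSpectrum.ae_unique
    ((S.s_lamb c i).hasSpectrum.add ((S.s_energy c).hasSpectrum.pd i))
    (Eventually.of_forall (S.adv_eq_lamb_add c i))

theorem spectrum_adv_eq_div (i : Fin 3) : l2Fourier (S.adv c i) =ᵐ[volume] fun ξ =>
    ∑ j, symD j ξ * l2Fourier (fun x => S.vel c j x * S.vel c i x) ξ :=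
  (S.s_adv c i).hasSpectrum.ae_unique
    (HasSpectrum.sum Finset.univ fun j _ =>
      ((S.s_vel c j).mul (S.s_vel c i)).hasSpectrum.pd j)
    (Eventually.of_forall (S.adv_eq_div c i))

/-- Taking the divergence of the advection in both its forms shows that the sum of pressure and
kinetic energy density solves a Poisson equation whose source is the divergence of ω × u. -/
theorem symΛ_sq_mul_pressureSpectrum : ∀ᵐ ξ : E3, symΛ ξ ^ 2 * S.pressureSpectrum c ξ =
    ∑ i, symD i ξ * l2Fourier (S.lamb c i) ξ - symΛ ξ ^ 2 * l2Fourier (S.energy c) ξ := by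
  have ha := fun i => S.spectrum_adv c i
  have hd := fun i => S.spectrum_adv_eq_div c i
  filter_upwards [ha 0, ha 1, ha 2, hd 0, hd 1, hd 2, ae_coord_zero_ne_zero]
    with ξ a0 a1 a2 d0 d1 d2 hξ
  have hL := symΛ_ne_zero hξ
  have e : symΛ ξ ^ 2 * S.pressureSpectrum c ξ = ∑ i, symD i ξ * l2Fourier (S.adv c i) ξ := by
    simp only [Fin.sum_univ_three, d0, d1, d2, pressureSpectrum, Pi.mul_apply, Pi.inv_apply]
    field_simp
  rw [e]
  simp only [Fin.sum_univ_three, a0, a1, a2]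
  linear_combination l2Fourier (S.energy c) ξ * (symD_sq_add ξ - symΛ_sq ξ * (-1))

end FieldSystem

/-! ### The scalar equation in terms of the fields -/

theorem field_neg_arg {σ g : E3 → ℂ} (hσ : TemperedSymbol σ) (hg : RapidL2 g) (s : ℂ)
    (h : ∀ ξ, σ (-ξ) * g (-ξ) = s * (σ ξ * g ξ)) (x : E3) :
    field σ g (-x) = s * field σ g x := by
  have h1 := (hasSpectrum_field hσ hg).comp_neg
  have h2 := (hasSpectrum_field hσ hg).const_mul s
  exact congrFun (h1.eq_of_ae_eq h2 (Eventually.of_forall h)) x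

theorem fourier_neg_arg {f : E3 → ℂ} (s : ℂ) (h : ∀ x, f (-x) = s * f x) (ξ : E3) :
    𝓕 f (-ξ) = s * 𝓕 f ξ := by
  have h1 := Real.fourier_comp_linearIsometry (LinearIsometryEquiv.neg ℝ : E3 ≃ₗᵢ[ℝ] E3) f ξ
  have e : f ∘ (LinearIsometryEquiv.neg ℝ : E3 ≃ₗᵢ[ℝ] E3) = fun x => s * f x := funext h
  rw [e] at h1
  change _ = 𝓕 f (-ξ) at h1
  rw [← h1, Real.fourier_eq, Real.fourier_eq, ← integral_const_mul]
  refine integral_congr_ae (Eventually.of_forall fun y => ?_)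
  simp only [Circle.smul_def, smul_eq_mul]
  ring

theorem evenSum_neg (g : E3 → ℂ) (ξ : E3) : evenSum g (-ξ) = evenSum g ξ := by
  simp only [evenSum, neg_neg, add_comm]

theorem oddSum_neg (g : E3 → ℂ) (ξ : E3) : oddSum g (-ξ) = -oddSum g ξ := by
  simp only [oddSum, neg_neg, neg_sub]

section

variable {g : E3 → ℂ} (hg : RapidL2 g) (hx : AxialSpectrum g)

/-- Every derivative flips the parity and Λ, Λ' keep it. In particular h, k and β are odd, so the
velocity is odd under x ↦ -x; this is the symmetry that lets one scalar carry both components. -/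
theorem fieldsOf_neg (x : E3) :
    ((fieldsOf g hg hx).h0 (-x) = -1 * (fieldsOf g hg hx).h0 x ∧
      (fieldsOf g hg hx).h1 (-x) = -1 * (fieldsOf g hg hx).h1 x ∧
      (fieldsOf g hg hx).z0 (-x) = 1 * (fieldsOf g hg hx).z0 x ∧
      (fieldsOf g hg hx).z1 (-x) = 1 * (fieldsOf g hg hx).z1 x) ∧
    ((fieldsOf g hg hx).k0 (-x) = -1 * (fieldsOf g hg hx).k0 x ∧
      (fieldsOf g hg hx).k1 (-x) = -1 * (fieldsOf g hg hx).k1 x ∧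
      (fieldsOf g hg hx).l0 (-x) = 1 * (fieldsOf g hg hx).l0 x ∧
      (fieldsOf g hg hx).l1 (-x) = 1 * (fieldsOf g hg hx).l1 x) ∧
    ((fieldsOf g hg hx).α (-x) = 1 * (fieldsOf g hg hx).α x ∧
      (fieldsOf g hg hx).α0 (-x) = -1 * (fieldsOf g hg hx).α0 x ∧
      (fieldsOf g hg hx).α1 (-x) = -1 * (fieldsOf g hg hx).α1 x ∧
      (fieldsOf g hg hx).αz (-x) = -1 * (fieldsOf g hg hx).αz x) ∧
    ((fieldsOf g hg hx).β (-x) = -1 * (fieldsOf g hg hx).β x ∧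
      (fieldsOf g hg hx).β0 (-x) = 1 * (fieldsOf g hg hx).β0 x ∧
      (fieldsOf g hg hx).β1 (-x) = 1 * (fieldsOf g hg hx).β1 x ∧
      (fieldsOf g hg hx).βz (-x) = 1 * (fieldsOf g hg hx).βz x ∧
      (fieldsOf g hg hx).γ (-x) = -1 * (fieldsOf g hg hx).γ x) := by
  refine ⟨⟨?_, ?_, ?_, ?_⟩, ⟨?_, ?_, ?_, ?_⟩, ⟨?_, ?_, ?_, ?_⟩, ?_, ?_, ?_, ?_, ?_⟩
  · exact field_neg_arg temperedSymbol_symD_zero_mul_inv hg.evenSum _ (fun ξ => by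
      simp only [Pi.mul_apply, Pi.inv_apply, symD_neg, symΛh_neg, evenSum_neg]; ring) x
  · exact field_neg_arg temperedSymbol_symD_one_mul_inv hg.evenSum _ (fun ξ => by
      simp only [Pi.mul_apply, Pi.inv_apply, symD_neg, symΛh_neg, evenSum_neg]; ring) x
  · exact field_neg_arg tempered_z0 hg.evenSum _ (fun ξ => by
      simp only [Pi.mul_apply, Pi.inv_apply, symD_neg, symΛh_neg, evenSum_neg]; ring) x
  · exact field_neg_arg tempered_z1 hg.evenSum _ (fun ξ => by
      simp only [Pi.mul_apply, Pi.inv_apply, symD_neg, symΛh_neg, evenSum_neg]; ring) x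
  · exact field_neg_arg tempered_k0 hg.oddSum _ (fun ξ => by
      simp only [Pi.mul_apply, Pi.inv_apply, symD_neg, symΛh_neg, symΛ_neg, oddSum_neg]; ring) x
  · exact field_neg_arg tempered_k1 hg.oddSum _ (fun ξ => by
      simp only [Pi.mul_apply, Pi.inv_apply, symD_neg, symΛh_neg, symΛ_neg, oddSum_neg]; ring) x
  · exact field_neg_arg tempered_l0 hg.oddSum _ (fun ξ => by
      simp only [Pi.mul_apply, Pi.inv_apply, symD_neg, symΛh_neg, symΛ_neg, oddSum_neg]; ring) x
  · exact field_neg_arg tempered_l1 hg.oddSum _ (fun ξ => by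
      simp only [Pi.mul_apply, Pi.inv_apply, symD_neg, symΛh_neg, symΛ_neg, oddSum_neg]; ring) x
  · exact field_neg_arg temperedSymbol_symΛh hg.evenSum _ (fun ξ => by
      simp only [symΛh_neg, evenSum_neg]; ring) x
  · exact field_neg_arg ((temperedSymbol_symD 0).mul temperedSymbol_symΛh) hg.evenSum _
      (fun ξ => by simp only [Pi.mul_apply, symD_neg, symΛh_neg, evenSum_neg]; ring) x
  · exact field_neg_arg ((temperedSymbol_symD 1).mul temperedSymbol_symΛh) hg.evenSum _
      (fun ξ => by simp only [Pi.mul_apply, symD_neg, symΛh_neg, evenSum_neg]; ring) x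
  · exact field_neg_arg (temperedSymbol_symΛh.mul (temperedSymbol_symD 2)) hg.evenSum _
      (fun ξ => by simp only [Pi.mul_apply, symD_neg, symΛh_neg, evenSum_neg]; ring) x
  · exact field_neg_arg temperedSymbol_symΛh_mul_inv hg.oddSum _ (fun ξ => by
      simp only [Pi.mul_apply, Pi.inv_apply, symΛh_neg, symΛ_neg, oddSum_neg]; ring) x
  · exact field_neg_arg ((temperedSymbol_symD 0).mul temperedSymbol_symΛh_mul_inv) hg.oddSum _
      (fun ξ => by
        simp only [Pi.mul_apply, Pi.inv_apply, symD_neg, symΛh_neg, symΛ_neg, oddSum_neg]; ring) x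
  · exact field_neg_arg ((temperedSymbol_symD 1).mul temperedSymbol_symΛh_mul_inv) hg.oddSum _
      (fun ξ => by
        simp only [Pi.mul_apply, Pi.inv_apply, symD_neg, symΛh_neg, symΛ_neg, oddSum_neg]; ring) x
  · exact field_neg_arg (temperedSymbol_symΛh_mul_inv.mul (temperedSymbol_symD 2)) hg.oddSum _
      (fun ξ => by
        simp only [Pi.mul_apply, Pi.inv_apply, symD_neg, symΛh_neg, symΛ_neg, oddSum_neg]; ring) x
  · exact field_neg_arg (temperedSymbol_symΛ.mul temperedSymbol_symΛh) hg.oddSum _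
      (fun ξ => by simp only [Pi.mul_apply, symΛh_neg, symΛ_neg, oddSum_neg]; ring) x

set_option linter.unusedSimpArgs false in
theorem swirlForce_neg (ξ : E3) :
    (fieldsOf g hg hx).swirlForce (-ξ) = (fieldsOf g hg hx).swirlForce ξ := by
  have h := fieldsOf_neg hg hx
  simp only [FieldSystem.swirlForce]
  rw [fourier_neg_arg 1 (fun x => ?_), fourier_neg_arg 1 (fun x => ?_),
    fourier_neg_arg 1 (fun x => ?_), fourier_neg_arg 1 (fun x => ?_)]
  · ring
  all_goals
    obtain ⟨⟨a1, a2, a3, a4⟩, ⟨b1, b2, b3, b4⟩, ⟨c1, c2, c3, c4⟩, d1, d2, d3, d4, d5⟩ := h x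
    simp only [hdot, a1, a2, a3, a4, b1, b2, b3, b4, c1, c2, c3, c4, d1, d2, d3, d4, d5]
    ring

set_option linter.unusedSimpArgs false in
theorem horizontalForce_neg (ξ : E3) :
    (fieldsOf g hg hx).horizontalForce (-ξ) = (fieldsOf g hg hx).horizontalForce ξ := by
  have h := fieldsOf_neg hg hx
  simp only [FieldSystem.horizontalForce]
  rw [fourier_neg_arg 1 (fun x => ?_), fourier_neg_arg 1 (fun x => ?_),
    fourier_neg_arg 1 (fun x => ?_), fourier_neg_arg 1 (fun x => ?_)]
  · ring
  all_goals
    obtain ⟨⟨a1, a2, a3, a4⟩, ⟨b1, b2, b3, b4⟩, ⟨c1, c2, c3, c4⟩, d1, d2, d3, d4, d5⟩ := h x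
    simp only [hdot, a1, a2, a3, a4, b1, b2, b3, b4, c1, c2, c3, c4, d1, d2, d3, d4, d5]
    ring

set_option linter.unusedSimpArgs false in
theorem verticalForce_neg (ξ : E3) :
    (fieldsOf g hg hx).verticalForce (-ξ) = -(fieldsOf g hg hx).verticalForce ξ := by
  have h := fieldsOf_neg hg hx
  simp only [FieldSystem.verticalForce]
  rw [fourier_neg_arg (-1) (fun x => ?_), fourier_neg_arg (-1) (fun x => ?_)]
  · ring
  all_goals
    obtain ⟨⟨a1, a2, a3, a4⟩, ⟨b1, b2, b3, b4⟩, ⟨c1, c2, c3, c4⟩, d1, d2, d3, d4, d5⟩ := h x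
    simp only [hdot, a1, a2, a3, a4, b1, b2, b3, b4, c1, c2, c3, c4, d1, d2, d3, d4, d5]
    ring

theorem mul_ae_eq {f f' F F' : E3 → ℂ} (h : f =ᵐ[volume] F) (h' : f' =ᵐ[volume] F') :
    (fun x => f x * f' x) =ᵐ[volume] fun x => F x * F' x := h.mul h'

theorem scalarRHS_eq {v : E3 → ℝ} (hv : HasSpectrum (fun x => (v x : ℂ)) g) (ξ : E3) :
    scalarRHS v ξ = (symΛh * symΛ⁻¹) ξ * (fieldsOf g hg hx).verticalForce ξ
      + (symΛh⁻¹ * symΛ⁻¹ * symD 2) ξ * (fieldsOf g hg hx).horizontalForce ξ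
      + (symΛh⁻¹) ξ * (fieldsOf g hg hx).swirlForce ξ := by
  set S := fieldsOf g hg hx with hS
  have ha : HasSpectrum (fun x => ((v x + v (-x) : ℝ) : ℂ)) (evenSum g) :=
    (hv.add hv.comp_neg).congr_fun (by ext x; push_cast; rfl)
  have hb : HasSpectrum (fun x => ((v x - v (-x) : ℝ) : ℂ)) (oddSum g) :=
    (hv.sub hv.comp_neg).congr_fun (by ext x; push_cast; rfl)
  have mh0 := ha.multiplier_ae_eq (hg.evenSum.symbol_mul temperedSymbol_symD_zero_mul_inv)
  have mh1 := ha.multiplier_ae_eq (hg.evenSum.symbol_mul temperedSymbol_symD_one_mul_inv)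
  have mz0 := ha.multiplier_ae_eq (hg.evenSum.symbol_mul tempered_z0)
  have mz1 := ha.multiplier_ae_eq (hg.evenSum.symbol_mul tempered_z1)
  have mk0 := hb.multiplier_ae_eq (hg.oddSum.symbol_mul tempered_k0)
  have mk1 := hb.multiplier_ae_eq (hg.oddSum.symbol_mul tempered_k1)
  have ml0 := hb.multiplier_ae_eq (hg.oddSum.symbol_mul tempered_l0)
  have ml1 := hb.multiplier_ae_eq (hg.oddSum.symbol_mul tempered_l1)
  have mα := ha.multiplier_ae_eq (hg.evenSum.symbol_mul temperedSymbol_symΛh)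
  have mα0 := ha.multiplier_ae_eq
    (hg.evenSum.symbol_mul ((temperedSymbol_symD 0).mul temperedSymbol_symΛh))
  have mα1 := ha.multiplier_ae_eq
    (hg.evenSum.symbol_mul ((temperedSymbol_symD 1).mul temperedSymbol_symΛh))
  have mαz := ha.multiplier_ae_eq
    (hg.evenSum.symbol_mul (temperedSymbol_symΛh.mul (temperedSymbol_symD 2)))
  have mβ := hb.multiplier_ae_eq (hg.oddSum.symbol_mul temperedSymbol_symΛh_mul_inv)
  have mβ0 := hb.multiplier_ae_eq
    (hg.oddSum.symbol_mul ((temperedSymbol_symD 0).mul temperedSymbol_symΛh_mul_inv))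
  have mβ1 := hb.multiplier_ae_eq
    (hg.oddSum.symbol_mul ((temperedSymbol_symD 1).mul temperedSymbol_symΛh_mul_inv))
  have mβz := hb.multiplier_ae_eq
    (hg.oddSum.symbol_mul (temperedSymbol_symΛh_mul_inv.mul (temperedSymbol_symD 2)))
  have mγ := hb.multiplier_ae_eq
    (hg.oddSum.symbol_mul (temperedSymbol_symΛ.mul temperedSymbol_symΛh))
  have q1 := radialDeriv_mul_ae_eq mh0 mh1 mz0 mz1 S.radial_h S.radial_z
  have q2 := radialDeriv_mul_ae_eq mk0 mk1 ml0 ml1 S.radial_k S.radial_l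
  have q3 := radialDeriv_mul_ae_eq mβ0 mβ1 ml0 ml1 S.radial_β S.radial_l
  have q5 := radialDeriv_mul_ae_eq mβ0 mβ1 mz0 mz1 S.radial_β S.radial_z
  have q7 := radialDeriv_mul_ae_eq mh0 mh1 mα0 mα1 S.radial_h S.radial_α
  have q9 := radialDeriv_mul_ae_eq mk0 mk1 mα0 mα1 S.radial_k S.radial_α
  -- Of the ten braces, the first two form the vertical force, the third, fourth, seventh and eighth
  -- the horizontal one, and the others the swirl force.
  simp only [scalarRHS, mul_comm symΛ⁻¹ symΛh]
  rw [Real.fourier_congr_ae q1, Real.fourier_congr_ae q2, Real.fourier_congr_ae q3,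
    Real.fourier_congr_ae (mul_ae_eq mβ mγ), Real.fourier_congr_ae q5, Real.fourier_congr_ae (mul_ae_eq mβ mαz),
    Real.fourier_congr_ae q7, Real.fourier_congr_ae (mul_ae_eq mα mα), Real.fourier_congr_ae q9,
    Real.fourier_congr_ae (mul_ae_eq mβz mα)]
  change _ = (symΛh * symΛ⁻¹) ξ * (𝓕 (hdot S.h0 S.h1 S.z0 S.z1) ξ - 𝓕 (hdot S.k0 S.k1 S.l0 S.l1) ξ)
    + (symΛh⁻¹ * symΛ⁻¹ * symD 2) ξ * (𝓕 (hdot S.β0 S.β1 S.l0 S.l1) ξ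
      - 𝓕 (fun x => S.β x * S.γ x) ξ - 𝓕 (hdot S.h0 S.h1 S.α0 S.α1) ξ
      + 𝓕 (fun x => S.α x * S.α x) ξ)
    + (symΛh⁻¹) ξ * (𝓕 (hdot S.β0 S.β1 S.z0 S.z1) ξ - 𝓕 (fun x => S.β x * S.αz x) ξ
      - 𝓕 (hdot S.k0 S.k1 S.α0 S.α1) ξ + 𝓕 (fun x => S.βz x * S.α x) ξ)
  have e : symD 2 * symΛh⁻¹ * symΛ⁻¹ = symΛh⁻¹ * symΛ⁻¹ * symD 2 := by ring
  rw [e]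
  ring!

end

/-! ### The spectrum of the velocity -/

/-- The spectrum of the velocity generated by the scalar spectrum `G`. -/
noncomputable def velSpec (c : ℂ) (G : E3 → ℂ) : Fin 3 → E3 → ℂ :=
  ![fun ξ => c * ((symD 0 * (symΛh⁻¹ * symΛ⁻¹ * symD 2)) ξ * oddSum G ξ
      - (symD 1 * symΛh⁻¹) ξ * evenSum G ξ),
    fun ξ => c * ((symD 0 * symΛh⁻¹) ξ * evenSum G ξ
      + (symD 1 * (symΛh⁻¹ * symΛ⁻¹ * symD 2)) ξ * oddSum G ξ),
    fun ξ => c * ((symΛh * symΛ⁻¹) ξ * oddSum G ξ)]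

theorem hasSpectrum_vel {g : E3 → ℂ} (hg : RapidL2 g) (hx : AxialSpectrum g) (c : ℂ) (i : Fin 3) :
    HasSpectrum ((fieldsOf g hg hx).vel c i) (velSpec c g i) := by
  fin_cases i
  · exact ((hasSpectrum_field tempered_k0 hg.oddSum).sub
      (hasSpectrum_field temperedSymbol_symD_one_mul_inv hg.evenSum)).const_mul c
  · exact ((hasSpectrum_field temperedSymbol_symD_zero_mul_inv hg.evenSum).add
      (hasSpectrum_field tempered_k1 hg.oddSum)).const_mul c
  · exact (hasSpectrum_field temperedSymbol_symΛh_mul_inv hg.oddSum).const_mul c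

theorem rapidL2_velSpec {G : E3 → ℂ} (hG : RapidL2 G) (c : ℂ) (i : Fin 3) :
    RapidL2 (velSpec c G i) := by
  fin_cases i
  · exact ((hG.oddSum.symbol_mul tempered_k0).sub
      (hG.evenSum.symbol_mul temperedSymbol_symD_one_mul_inv)).const_mul c
  · exact ((hG.evenSum.symbol_mul temperedSymbol_symD_zero_mul_inv).add
      (hG.oddSum.symbol_mul tempered_k1)).const_mul c
  · exact (hG.oddSum.symbol_mul temperedSymbol_symΛh_mul_inv).const_mul c

theorem velSpec_sub (c : ℂ) (G G' : E3 → ℂ) (i : Fin 3) (ξ : E3) :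
    velSpec c (fun ξ => G ξ - G' ξ) i ξ = velSpec c G i ξ - velSpec c G' i ξ := by
  fin_cases i
  all_goals
    simp only [velSpec, oddSum, evenSum, Fin.zero_eta, Fin.mk_one, Fin.reduceFinMk,
      Matrix.cons_val]
    ring

theorem velSpec_const_mul (c a : ℂ) (G : E3 → ℂ) (i : Fin 3) (ξ : E3) :
    velSpec c (fun ξ => a * G ξ) i ξ = a * velSpec c G i ξ := by
  fin_cases i
  all_goals
    simp only [velSpec, oddSum, evenSum, Fin.zero_eta, Fin.mk_one, Fin.reduceFinMk,
      Matrix.cons_val]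
    ring

theorem norm_mul_inv_le_one {σ τ : E3 → ℂ} (h : ∀ ξ, ‖σ ξ‖ ≤ ‖τ ξ‖) (ξ : E3) :
    ‖(σ * τ⁻¹) ξ‖ ≤ 1 := by
  rw [Pi.mul_apply, Pi.inv_apply, norm_mul, norm_inv]
  exact div_le_one_of_le₀ (h ξ) (norm_nonneg _)

theorem norm_velSpec_le (c : ℂ) (G : E3 → ℂ) (i : Fin 3) (ξ : E3) :
    ‖velSpec c G i ξ‖ ≤ 2 * ‖c‖ * (‖G ξ‖ + ‖G (-ξ)‖) := by
  have ho : ‖oddSum G ξ‖ ≤ ‖G ξ‖ + ‖G (-ξ)‖ := norm_sub_le _ _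
  have he : ‖evenSum G ξ‖ ≤ ‖G ξ‖ + ‖G (-ξ)‖ := norm_add_le _ _
  have h0 := norm_mul_inv_le_one norm_symD_zero_le ξ
  have h1 := norm_mul_inv_le_one norm_symD_one_le ξ
  have h2 := norm_mul_inv_le_one (norm_symD_le 2) ξ
  have hh := norm_mul_inv_le_one norm_symΛh_le ξ
  have hk : ∀ j : Fin 3, ‖(symD j * symΛh⁻¹) ξ‖ ≤ 1 →
      ‖(symD j * (symΛh⁻¹ * symΛ⁻¹ * symD 2)) ξ‖ ≤ 1 := by
    intro j hj
    have e : symD j * (symΛh⁻¹ * symΛ⁻¹ * symD 2) = (symD j * symΛh⁻¹) * (symD 2 * symΛ⁻¹) := by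
      ring
    rw [e, Pi.mul_apply, norm_mul]
    exact mul_le_one₀ hj (norm_nonneg _) h2
  have key : ∀ a z : ℂ, ‖a‖ ≤ 1 → ‖z‖ ≤ ‖G ξ‖ + ‖G (-ξ)‖ → ‖a * z‖ ≤ ‖G ξ‖ + ‖G (-ξ)‖ := by
    intro a z ha hz
    rw [norm_mul]
    exact (mul_le_of_le_one_left (norm_nonneg _) ha).trans hz
  have hc := norm_nonneg c
  fin_cases i
  · change ‖c * (_ - _)‖ ≤ _
    rw [norm_mul]
    have := (norm_sub_le _ _).trans (add_le_add (key _ _ (hk 0 h0) ho) (key _ _ h1 he))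
    nlinarith
  · change ‖c * (_ + _)‖ ≤ _
    rw [norm_mul]
    have := (norm_add_le _ _).trans (add_le_add (key _ _ h0 he) (key _ _ (hk 1 h1) ho))
    nlinarith
  · change ‖c * _‖ ≤ _
    rw [norm_mul]
    have := key _ _ hh ho
    have h3 : 0 ≤ ‖G ξ‖ + ‖G (-ξ)‖ := by positivity
    nlinarith

/-- The normalization `1 / √2` of the velocity. -/
noncomputable def cst : ℂ := ((Real.sqrt 2)⁻¹ : ℝ)

theorem cst_sq : cst ^ 2 = 1 / 2 := by
  have h : (Real.sqrt 2)⁻¹ ^ 2 = (1 / 2 : ℝ) := by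
    rw [inv_pow, Real.sq_sqrt (by norm_num)]; norm_num
  rw [cst, ← Complex.ofReal_pow, h]; norm_num

theorem sqrt_two_mul_cst : ((Real.sqrt 2 : ℝ) : ℂ) = 2 * cst := by
  have h : Real.sqrt 2 = 2 * (Real.sqrt 2)⁻¹ := by
    have : Real.sqrt 2 ≠ 0 := by positivity
    field_simp
    exact Real.sq_sqrt (by norm_num)
  rw [cst]
  exact_mod_cast h

/-- The two frame directions are orthonormal, so pairing û with them returns the even and odd sums
of G with bounded coefficients. G is half the sum of these, and 1/2 is `cst ^ 2`. -/
theorem norm_le_sum_velSpec (G : E3 → ℂ) {ξ : E3} (hξ : ξ 0 ≠ 0) :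
    ‖G ξ‖ ≤ 2 * ∑ i, ‖velSpec cst G i ξ‖ := by
  have hR := symΛh_ne_zero hξ
  have hL := symΛ_ne_zero hξ
  set U := fun i => velSpec cst G i ξ with hU
  have e0 : U 0 = cst * ((symD 0 * (symΛh⁻¹ * symΛ⁻¹ * symD 2)) ξ * oddSum G ξ
      - (symD 1 * symΛh⁻¹) ξ * evenSum G ξ) := rfl
  have e1 : U 1 = cst * ((symD 0 * symΛh⁻¹) ξ * evenSum G ξ
      + (symD 1 * (symΛh⁻¹ * symΛ⁻¹ * symD 2)) ξ * oddSum G ξ) := rfl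
  have e2 : U 2 = cst * ((symΛh * symΛ⁻¹) ξ * oddSum G ξ) := rfl
  have hs := symD_sq_add ξ
  have hl := symΛ_sq ξ
  have he : cst * evenSum G ξ = (symD 1 * symΛh⁻¹) ξ * U 0 - (symD 0 * symΛh⁻¹) ξ * U 1 := by
    rw [e0, e1]
    simp only [Pi.mul_apply, Pi.inv_apply]
    field_simp
    linear_combination cst * symΛ ξ * evenSum G ξ * hs
  have ho : cst * oddSum G ξ = (symΛh * symΛ⁻¹) ξ * U 2
      + (symD 2 * symΛ⁻¹) ξ * ((symD 0 * symΛh⁻¹) ξ * U 0 + (symD 1 * symΛh⁻¹) ξ * U 1) := by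
    rw [e0, e1, e2]
    simp only [Pi.mul_apply, Pi.inv_apply]
    field_simp
    linear_combination cst * oddSum G ξ * (symΛh ξ ^ 2 * hl - symD 2 ξ ^ 2 * hs)
  have hG : G ξ = cst * (cst * evenSum G ξ + cst * oddSum G ξ) := by
    simp only [evenSum, oddSum]
    linear_combination (-2 * G ξ) * cst_sq
  have hc : ‖cst‖ ≤ 1 := by
    rw [cst, Complex.norm_real, Real.norm_of_nonneg (by positivity)]
    exact inv_le_one_of_one_le₀ (Real.one_le_sqrt.2 (by norm_num))
  have h0 := norm_mul_inv_le_one norm_symD_zero_le ξ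
  have h1 := norm_mul_inv_le_one norm_symD_one_le ξ
  have h2 := norm_mul_inv_le_one (norm_symD_le 2) ξ
  have hh := norm_mul_inv_le_one norm_symΛh_le ξ
  have key : ∀ a z : ℂ, ‖a‖ ≤ 1 → ‖a * z‖ ≤ ‖z‖ := by
    intro a z ha
    rw [norm_mul]
    exact mul_le_of_le_one_left (norm_nonneg _) ha
  have b1 : ‖cst * evenSum G ξ‖ ≤ ‖U 0‖ + ‖U 1‖ := by
    rw [he]
    exact (norm_sub_le _ _).trans (add_le_add (key _ _ h1) (key _ _ h0))
  have b2 : ‖cst * oddSum G ξ‖ ≤ ‖U 2‖ + (‖U 0‖ + ‖U 1‖) := by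
    rw [ho]
    refine (norm_add_le _ _).trans (add_le_add (key _ _ hh) ((key _ _ h2).trans ?_))
    exact (norm_add_le _ _).trans (add_le_add (key _ _ h0) (key _ _ h1))
  rw [hG, Fin.sum_univ_three]
  have b3 := (key cst _ hc).trans ((norm_add_le _ _).trans (add_le_add b1 b2))
  have := norm_nonneg (U 2)
  calc _ ≤ _ := b3
    _ ≤ 2 * (‖U 0‖ + ‖U 1‖ + ‖U 2‖) := by linarith

/-! ### The momentum equation -/

section

variable {g : E3 → ℂ} (hg : RapidL2 g) (hx : AxialSpectrum g)

/-- Adding and subtracting the equation at ξ and at -ξ separates parities: swirl and horizontal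
forces are even, the vertical one is odd, and the symbol of ∂₃ is odd. -/
theorem scalar_equation_split {v : E3 → ℝ} (hv : HasSpectrum (fun x => (v x : ℂ)) g) {W : E3 → ℂ}
    {ν : ℝ} (h : ∀ᵐ ξ : E3, ((2 * Real.sqrt 2 : ℝ) : ℂ) * (W ξ + (ν : ℂ) * symΛ ξ ^ 2 * g ξ)
      = scalarRHS v ξ) : ∀ᵐ ξ : E3,
    2 * cst * (evenSum W ξ + ν * symΛ ξ ^ 2 * evenSum g ξ) =
      (symΛh ξ)⁻¹ * (fieldsOf g hg hx).swirlForce ξ ∧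
    2 * cst * (oddSum W ξ + ν * symΛ ξ ^ 2 * oddSum g ξ) =
      symΛh ξ * (symΛ ξ)⁻¹ * (fieldsOf g hg hx).verticalForce ξ
      + (symΛh ξ)⁻¹ * (symΛ ξ)⁻¹ * symD 2 ξ * (fieldsOf g hg hx).horizontalForce ξ := by
  filter_upwards [h, ae_comp_neg h] with ξ h1 h2
  have e : ((2 * Real.sqrt 2 : ℝ) : ℂ) = 4 * cst := by
    rw [Complex.ofReal_mul, sqrt_two_mul_cst]; push_cast; ring
  rw [scalarRHS_eq hg hx hv, e] at h1 h2
  rw [swirlForce_neg, horizontalForce_neg, verticalForce_neg] at h2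
  simp only [Pi.mul_apply, Pi.inv_apply, symD_neg, symΛh_neg, symΛ_neg] at h1 h2
  simp only [evenSum, oddSum]
  constructor
  · linear_combination (1 / 2) * (h1 + h2)
  · linear_combination (1 / 2) * (h1 - h2)

theorem spectral_momentum {v : E3 → ℝ} (hv : HasSpectrum (fun x => (v x : ℂ)) g) {W : E3 → ℂ}
    {ν : ℝ} (h : ∀ᵐ ξ : E3, ((2 * Real.sqrt 2 : ℝ) : ℂ) * (W ξ + (ν : ℂ) * symΛ ξ ^ 2 * g ξ)
      = scalarRHS v ξ) (i : Fin 3) : ∀ᵐ ξ : E3,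
    velSpec cst W i ξ + l2Fourier ((fieldsOf g hg hx).adv cst i) ξ
      + symD i ξ * (fieldsOf g hg hx).pressureSpectrum cst ξ
      = (ν : ℂ) * (∑ j, symD j ξ * (symD j ξ * velSpec cst g i ξ)) := by
  set S := fieldsOf g hg hx with hS
  filter_upwards [scalar_equation_split hg hx hv h, ae_coord_zero_ne_zero,
    S.spectrum_curl_lamb cst, S.spectrum_div_lamb cst, S.spectrum_lamb_two cst,
    S.spectrum_adv cst i, S.symΛ_sq_mul_pressureSpectrum cst] with ξ hsplit hξ hcurl hdiv htwo hadv hp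
  obtain ⟨hA, hB⟩ := hsplit
  have hR := symΛh_ne_zero hξ
  have hL := symΛ_ne_zero hξ
  have hs := symD_sq_add ξ
  have hl := symΛ_sq ξ
  have hc := cst_sq
  rw [hadv]
  rw [← hS] at hA hB
  set R := symΛh ξ
  set L := symΛ ξ
  set d0 := symD 0 ξ
  set d1 := symD 1 ξ
  set d2 := symD 2 ξ
  rw [Fin.sum_univ_three] at hp ⊢
  generalize l2Fourier (S.energy cst) ξ = E at *
  have hF0 : ∃ F0, l2Fourier (S.lamb cst 0) ξ = F0 := ⟨_, rfl⟩
  have hF1 : ∃ F1, l2Fourier (S.lamb cst 1) ξ = F1 := ⟨_, rfl⟩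
  have hF2 : ∃ F2, l2Fourier (S.lamb cst 2) ξ = F2 := ⟨_, rfl⟩
  obtain ⟨F0, hF0⟩ := hF0
  obtain ⟨F1, hF1⟩ := hF1
  obtain ⟨F2, hF2⟩ := hF2
  rw [hF0, hF1, hF2] at hp
  rw [hF0, hF1] at hcurl hdiv
  rw [hF2] at htwo
  have hp' : S.pressureSpectrum cst ξ = (d0 * F0 + d1 * F1 + d2 * F2) / L ^ 2 - E := by
    field_simp
    linear_combination hp
  set A := evenSum W ξ + ν * L ^ 2 * evenSum g ξ
  set B := oddSum W ξ + ν * L ^ 2 * oddSum g ξ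
  -- The toroidal and poloidal coefficients of the transform F of ω × u. The forces carry `cst ^ 2`
  -- = 1/2, which matches the normalization 2√2 of (S).
  have hA' : cst * A = (d0 * F1 - d1 * F0) / R := by
    field_simp at hA ⊢
    linear_combination (1 / 2) * hA - hcurl - S.swirlForce ξ * hc
  have hB' : cst * B = -(R / L) * F2 - d2 / (R * L) * (d0 * F0 + d1 * F1) := by
    rw [hdiv, htwo]
    field_simp at hB ⊢
    linear_combination (1 / 2) * hB
      - (R ^ 2 * S.verticalForce ξ + d2 * S.horizontalForce ξ) * hc
  have hlap : ∀ z : ℂ, d0 * (d0 * z) + d1 * (d1 * z) + d2 * (d2 * z) = -L ^ 2 * z := fun z => by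
    linear_combination z * (hs + hl)
  rw [hlap, hp']
  fin_cases i
  · have e1 : velSpec cst W 0 ξ + ν * L ^ 2 * velSpec cst g 0 ξ =
        d0 * (R⁻¹ * L⁻¹ * d2) * (cst * B) - d1 * R⁻¹ * (cst * A) := by
      change cst * (d0 * (R⁻¹ * L⁻¹ * d2) * oddSum W ξ - d1 * R⁻¹ * evenSum W ξ)
        + ν * L ^ 2 * (cst * (d0 * (R⁻¹ * L⁻¹ * d2) * oddSum g ξ - d1 * R⁻¹ * evenSum g ξ)) = _
      ring
    rw [hA', hB'] at e1
    change velSpec cst W 0 ξ + (l2Fourier (S.lamb cst 0) ξ + d0 * E) + d0 * _ = _ * (_ * velSpec cst g 0 ξ)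
    rw [hF0]
    -- Completeness of the frame: F is the sum of its toroidal, poloidal and gradient parts.
    have e2 : d0 * (R⁻¹ * L⁻¹ * d2) * (-(R / L) * F2 - d2 / (R * L) * (d0 * F0 + d1 * F1))
        - d1 * R⁻¹ * ((d0 * F1 - d1 * F0) / R) + F0 + d0 * ((d0 * F0 + d1 * F1 + d2 * F2) / L ^ 2)
        = 0 := by
      field_simp
      linear_combination (-(d0 * d1 * F1 + d0 ^ 2 * F0)) * hl + F0 * L ^ 2 * hs
    linear_combination e1 + e2
  · have e1 : velSpec cst W 1 ξ + ν * L ^ 2 * velSpec cst g 1 ξ =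
        d0 * R⁻¹ * (cst * A) + d1 * (R⁻¹ * L⁻¹ * d2) * (cst * B) := by
      change cst * (d0 * R⁻¹ * evenSum W ξ + d1 * (R⁻¹ * L⁻¹ * d2) * oddSum W ξ)
        + ν * L ^ 2 * (cst * (d0 * R⁻¹ * evenSum g ξ + d1 * (R⁻¹ * L⁻¹ * d2) * oddSum g ξ)) = _
      ring
    rw [hA', hB'] at e1
    change velSpec cst W 1 ξ + (l2Fourier (S.lamb cst 1) ξ + d1 * E) + d1 * _
      = _ * (_ * velSpec cst g 1 ξ)
    rw [hF1]
    have e2 : d0 * R⁻¹ * ((d0 * F1 - d1 * F0) / R)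
        + d1 * (R⁻¹ * L⁻¹ * d2) * (-(R / L) * F2 - d2 / (R * L) * (d0 * F0 + d1 * F1))
        + F1 + d1 * ((d0 * F0 + d1 * F1 + d2 * F2) / L ^ 2) = 0 := by
      field_simp
      linear_combination (-(d0 * d1 * F0 + d1 ^ 2 * F1)) * hl + F1 * L ^ 2 * hs
    linear_combination e1 + e2
  · have e1 : velSpec cst W 2 ξ + ν * L ^ 2 * velSpec cst g 2 ξ = R * L⁻¹ * (cst * B) := by
      change cst * (R * L⁻¹ * oddSum W ξ) + ν * L ^ 2 * (cst * (R * L⁻¹ * oddSum g ξ)) = _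
      ring
    rw [hB'] at e1
    change velSpec cst W 2 ξ + (l2Fourier (S.lamb cst 2) ξ + d2 * E) + d2 * _
      = _ * (_ * velSpec cst g 2 ξ)
    rw [hF2]
    have e2 : R * L⁻¹ * (-(R / L) * F2 - d2 / (R * L) * (d0 * F0 + d1 * F1))
        + F2 + d2 * ((d0 * F0 + d1 * F1 + d2 * F2) / L ^ 2) = 0 := by
      field_simp
      linear_combination F2 * hl
    linear_combination e1 + e2

/-- The velocity generated by a solution of the scalar equation satisfies the momentum equation. -/
theorem momentum {v : E3 → ℝ} (hv : HasSpectrum (fun x => (v x : ℂ)) g) {W : E3 → ℂ}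
    (hW : RapidL2 W) {ν : ℝ}
    (h : ∀ᵐ ξ : E3, ((2 * Real.sqrt 2 : ℝ) : ℂ) * (W ξ + (ν : ℂ) * symΛ ξ ^ 2 * g ξ)
      = scalarRHS v ξ) (i : Fin 3) (x : E3) :
    𝓕⁻ (velSpec cst W i) x + (fieldsOf g hg hx).adv cst i x
      + pd i (𝓕⁻ ((fieldsOf g hg hx).pressureSpectrum cst)) x
      = (ν : ℂ) * ∑ j, pd j (pd j ((fieldsOf g hg hx).vel cst i)) x := by
  set S := fieldsOf g hg hx
  have h1 := ((rapidL2_velSpec hW cst i).hasSpectrum.add (S.s_adv cst i).hasSpectrum).add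
    ((S.rapidL2_pressureSpectrum cst).hasSpectrum.pd i)
  have h2 := (HasSpectrum.sum Finset.univ fun j _ =>
    ((hasSpectrum_vel hg hx cst i).pd j).pd j).const_mul (ν : ℂ)
  exact congrFun (h1.eq_of_ae_eq h2 (spectral_momentum hg hx hv h i)) x

/-- The velocity generated by a real function is real. -/
theorem vel_real {v : E3 → ℝ} (hv : HasSpectrum (fun x => (v x : ℂ)) g) (i : Fin 3) (x : E3) :
    ((((fieldsOf g hg hx).vel cst i x).re : ℝ) : ℂ) = (fieldsOf g hg hx).vel cst i x := by
  have h1 := hasSpectrum_vel hg hx cst i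
  have hv' : ∀ᵐ ξ : E3, (starRingEnd ℂ) (g (-ξ)) = g ξ :=
    hv.conj.ae_unique hv (Eventually.of_forall fun y => Complex.conj_ofReal _)
  rw [← Complex.conj_eq_iff_re]
  refine congrFun (h1.conj.eq_of_ae_eq h1 ?_) x
  filter_upwards [hv', ae_comp_neg hv'] with ξ e1 e2
  have e1' : (starRingEnd ℂ) (g ξ) = g (-ξ) := by rw [← e1, Complex.conj_conj]
  have hD : ∀ j, (starRingEnd ℂ) (symD j ξ) = -symD j ξ := fun j => by
    simp only [symD, map_mul, Complex.conj_ofReal, Complex.conj_I]; ring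
  have hL : (starRingEnd ℂ) (symΛ ξ) = symΛ ξ := Complex.conj_ofReal _
  have hR : (starRingEnd ℂ) (symΛh ξ) = symΛh ξ := Complex.conj_ofReal _
  have hc : (starRingEnd ℂ) cst = cst := Complex.conj_ofReal _
  fin_cases i
  all_goals
    simp only [velSpec, oddSum, evenSum, Fin.zero_eta, Fin.mk_one, Fin.reduceFinMk,
      Matrix.cons_val, Pi.mul_apply, Pi.inv_apply, map_mul, map_sub, map_add, map_inv₀, symD_neg,
      symΛ_neg, symΛh_neg, hD, hL, hR, hc, e1, e1', neg_neg, map_neg]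

end

/-! ### The velocity field -/

/-- The velocity field generated by the scalar function `v`. -/
noncomputable def velocity (v : E3 → ℝ) (x : E3) : E3 :=
  WithLp.toLp 2 fun i => (𝓕⁻ (velSpec cst (l2Fourier fun y => (v y : ℂ)) i) x).re

/-- The complexified `i`-th coordinate. -/
noncomputable def coordC (i : Fin 3) : E3 →L[ℝ] ℂ :=
  Complex.ofRealCLM.comp (EuclideanSpace.proj i)

theorem eq_sum_smul_single (h : E3) : h = ∑ j, h j • (EuclideanSpace.single j 1 : E3) := by
  ext i
  fin_cases i <;> simp [Fin.sum_univ_three]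

theorem fderiv_apply_eq_sum_pd (f : E3 → ℂ) (x h : E3) :
    fderiv ℝ f x h = ∑ j, (h j : ℂ) * pd j f x := by
  conv_lhs => rw [eq_sum_smul_single h]
  simp [map_sum, pd]

theorem laplacian_eq_sum_pd {f : E3 → ℂ} (hf : ContDiff ℝ ∞ f) (x : E3) :
    (Δ f) x = ∑ j, pd j (pd j f) x := by
  rw [congrFun (InnerProductSpace.laplacian_eq_iteratedFDeriv_orthonormalBasis f
    (EuclideanSpace.basisFun (Fin 3) ℝ)) x]
  refine Finset.sum_congr rfl fun j _ => ?_
  rw [iteratedFDeriv_two_apply]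
  have hd : DifferentiableAt ℝ (fderiv ℝ f) x :=
    (((contDiff_infty.1 hf 2).fderiv_right (m := 1) (by norm_cast)).differentiable (by simp)) x
  have e : pd j f = fun y => fderiv ℝ f y (EuclideanSpace.single j 1) := rfl
  simp only [EuclideanSpace.basisFun_apply, Matrix.cons_val_zero, Matrix.cons_val_one, pd]
  have := (hd.hasFDerivAt.clm_apply (hasFDerivAt_const (EuclideanSpace.single j 1 : E3) x)).fderiv
  change _ = fderiv ℝ (fun y => fderiv ℝ f y (EuclideanSpace.single j 1)) x _
  rw [this]
  simp

theorem fderiv_apply_coord {u : E3 → E3} (hu : ContDiff ℝ ∞ u) (x h : E3) (i : Fin 3) :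
    (((fderiv ℝ u x h) i : ℝ) : ℂ) = fderiv ℝ (fun y => ((u y i : ℝ) : ℂ)) x h := by
  have h1 := ((coordC i).hasFDerivAt.comp x (hu.differentiable (by simp) x).hasFDerivAt).fderiv
  change fderiv ℝ (fun y => ((u y i : ℝ) : ℂ)) x = _ at h1
  rw [h1]
  rfl

theorem laplacian_coord {u : E3 → E3} (hu : ContDiff ℝ ∞ u) (x : E3) (i : Fin 3) :
    ((((Δ u) x) i : ℝ) : ℂ) = (Δ fun y => ((u y i : ℝ) : ℂ)) x := by
  have h1 : ContDiffAt ℝ 2 u x := (contDiff_infty.1 hu 2).contDiffAt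
  exact (h1.laplacian_CLM_comp_left (l := coordC i)).symm

theorem gradient_re_coord {P : E3 → ℂ} (hP : Differentiable ℝ P) (x : E3) (i : Fin 3) :
    (gradient (fun y => (P y).re) x) i = (pd i P x).re := by
  have h1 : (gradient (fun y => (P y).re) x) i =
      inner ℝ (gradient (fun y => (P y).re) x) (EuclideanSpace.single i 1) := by
    rw [EuclideanSpace.inner_single_right]; simp
  have h2 := (Complex.reCLM.hasFDerivAt.comp x (hP x).hasFDerivAt).fderiv
  change fderiv ℝ (fun y => (P y).re) x = _ at h2
  rw [h1, inner_gradient_left, h2]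
  rfl

/-- The fields of an axisymmetric function. -/
noncomputable def fieldsOfFun {v : E3 → ℝ} (hv : IsHInfty v) (hax : IsAxisymmetric v) : FieldSystem :=
  fieldsOf _ (rapidL2_l2Fourier hv)
    (axialSpectrum_of_isAxisymmetric hax (hasSpectrum_of_isHInfty hv))

theorem velocity_coord {v : E3 → ℝ} (hv : IsHInfty v) (hax : IsAxisymmetric v)
    (i : Fin 3) (x : E3) :
    ((velocity v x i : ℝ) : ℂ) = (fieldsOfFun hv hax).vel cst i x := by
  rw [fieldsOfFun, ← vel_real _ _ (hasSpectrum_of_isHInfty hv), (hasSpectrum_vel _ _ cst i).eq]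
  rfl

theorem hasSpectrum_velocity {v : E3 → ℝ} (hv : IsHInfty v) (hax : IsAxisymmetric v)
    (i : Fin 3) : HasSpectrum (fun x => ((velocity v x i : ℝ) : ℂ))
    (velSpec cst (l2Fourier fun y => (v y : ℂ)) i) :=
  (hasSpectrum_vel _ _ cst i).congr_fun (funext fun x => (velocity_coord hv hax i x).symm)

theorem isHInfty_velocity {v : E3 → ℝ} (hv : IsHInfty v) (hax : IsAxisymmetric v) (i : Fin 3) :
    IsHInfty fun x => velocity v x i :=
  isHInfty_of_hasSpectrum (hasSpectrum_velocity hv hax i)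

theorem contDiff_velocity {v : E3 → ℝ} (hv : IsHInfty v) (hax : IsAxisymmetric v) :
    ContDiff ℝ ∞ (velocity v) :=
  contDiff_euclidean.2 fun i => (isHInfty_velocity hv hax i).contDiff

theorem memLp_velocity {v : E3 → ℝ} (hv : IsHInfty v) (hax : IsAxisymmetric v) :
    MemLp (velocity v) 2 volume :=
  MemLp.of_eval_piLp fun i => (isHInfty_velocity hv hax i).memLp

theorem divergence_velocity {v : E3 → ℝ} (hv : IsHInfty v) (hax : IsAxisymmetric v) (x : E3) :
    divergence (velocity v) x = 0 := by
  have h : ((divergence (velocity v) x : ℝ) : ℂ) = 0 := by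
    rw [divergence, Complex.ofReal_sum, ← (fieldsOfFun hv hax).div_vel cst x]
    refine Finset.sum_congr rfl fun i _ => ?_
    rw [fderiv_apply_coord (contDiff_velocity hv hax), funext (velocity_coord hv hax i)]
    rfl
  exact_mod_cast h

/-- The pressure of the flow generated by an axisymmetric function. -/
noncomputable def pressure {v : E3 → ℝ} (hv : IsHInfty v) (hax : IsAxisymmetric v) (x : E3) : ℝ :=
  (𝓕⁻ ((fieldsOfFun hv hax).pressureSpectrum cst) x).re

theorem contDiff_pressure {v : E3 → ℝ} (hv : IsHInfty v) (hax : IsAxisymmetric v) :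
    ContDiff ℝ ∞ (pressure hv hax) :=
  Complex.reCLM.contDiff.comp
    ((fieldsOfFun hv hax).rapidL2_pressureSpectrum cst).hasSpectrum.contDiff

theorem momentum_velocity {v w : E3 → ℝ} (hv : IsHInfty v) (hax : IsAxisymmetric v)
    (hw : IsHInfty w) {ν : ℝ}
    (h : ∀ᵐ ξ : E3, ((2 * Real.sqrt 2 : ℝ) : ℂ) * (l2Fourier (fun x => (w x : ℂ)) ξ
      + (ν : ℂ) * symΛ ξ ^ 2 * l2Fourier (fun x => (v x : ℂ)) ξ) = scalarRHS v ξ) (x : E3) :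
    velocity w x + fderiv ℝ (velocity v) x (velocity v x) + gradient (pressure hv hax) x
      = ν • (Δ (velocity v)) x := by
  have hu := contDiff_velocity hv hax
  have hP := ((fieldsOfFun hv hax).rapidL2_pressureSpectrum cst).hasSpectrum.differentiable
  ext i
  have hm := momentum (rapidL2_l2Fourier hv)
    (axialSpectrum_of_isAxisymmetric hax (hasSpectrum_of_isHInfty hv))
    (hasSpectrum_of_isHInfty hv) (rapidL2_l2Fourier hw) h i x
  have hS : (fieldsOf _ (rapidL2_l2Fourier hv)
    (axialSpectrum_of_isAxisymmetric hax (hasSpectrum_of_isHInfty hv))) = fieldsOfFun hv hax := rfl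
  rw [hS] at hm
  have h1 : (fieldsOfFun hv hax).adv cst i x =
      (((fderiv ℝ (velocity v) x (velocity v x)) i : ℝ) : ℂ) := by
    rw [fderiv_apply_coord hu, funext (velocity_coord hv hax i), fderiv_apply_eq_sum_pd]
    simp only [velocity_coord hv hax]
    rfl
  have h2 : ∑ j, pd j (pd j ((fieldsOfFun hv hax).vel cst i)) x =
      ((((Δ (velocity v)) x) i : ℝ) : ℂ) := by
    rw [laplacian_coord hu, funext (velocity_coord hv hax i),
      laplacian_eq_sum_pd ((fieldsOfFun hv hax).s_vel cst i).contDiff]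
  have h3 : (gradient (pressure hv hax) x) i = _ := gradient_re_coord hP x i
  rw [h1, h2] at hm
  -- Real parts suffice: `velocity w` and the pressure are real parts by definition, and the
  -- advection and viscous terms are already real.
  have hre := congrArg Complex.re hm
  rw [Complex.add_re, Complex.add_re, Complex.ofReal_re, ← h3, ← Complex.ofReal_mul,
    Complex.ofReal_re] at hre
  exact hre

/-! ### Time dependence -/

theorem eLpNorm_velSpec_le {G : E3 → ℂ} (hG : RapidL2 G) (i : Fin 3) (m : ℕ) :
    eLpNorm (fun ξ => ((jb ξ ^ m : ℝ) : ℂ) * velSpec cst G i ξ) 2 volume ≤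
      ENNReal.ofReal (2 * ‖cst‖) *
        (2 * eLpNorm (fun ξ => ((jb ξ ^ m : ℝ) : ℂ) * G ξ) 2 volume) := by
  have h1 : MemLp (fun ξ => ((jb ξ ^ m : ℝ) : ℂ) * G (-ξ)) 2 volume :=
    (hG.comp_isometry (LinearIsometryEquiv.neg ℝ)) m
  have h2 : eLpNorm (fun ξ => ((jb ξ ^ m : ℝ) : ℂ) * G (-ξ)) 2 volume =
      eLpNorm (fun ξ => ((jb ξ ^ m : ℝ) : ℂ) * G ξ) 2 volume := by
    rw [← eLpNorm_comp_measurePreserving (hG m).1 (Measure.measurePreserving_neg volume)]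
    refine congrArg (fun F : E3 → ℂ => eLpNorm F 2 volume) (funext fun ξ => ?_)
    simp [jb_neg]
  calc _ ≤ ENNReal.ofReal (2 * ‖cst‖) * eLpNorm (fun ξ => ‖((jb ξ ^ m : ℝ) : ℂ) * G ξ‖
          + ‖((jb ξ ^ m : ℝ) : ℂ) * G (-ξ)‖) 2 volume := by
        refine eLpNorm_le_mul_eLpNorm_of_ae_le_mul (Eventually.of_forall fun ξ => ?_) 2
        have h3 : 0 ≤ jb ξ ^ m := (pow_pos (jb_pos ξ) m).le
        rw [Real.norm_of_nonneg (by positivity), norm_mul, norm_mul, norm_mul, Complex.norm_real,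
          Real.norm_of_nonneg h3]
        have := mul_le_mul_of_nonneg_left (norm_velSpec_le cst G i ξ) h3
        linarith
    _ ≤ _ := by
        gcongr
        refine (eLpNorm_add_le (hG m).1.norm h1.1.norm (by norm_num)).trans ?_
        rw [eLpNorm_norm, eLpNorm_norm, h2, two_mul]

theorem enorm_fourierInv_le {G : E3 → ℂ} (hG : RapidL2 G) (x : E3) :
    ‖𝓕⁻ G x‖ₑ ≤ eLpNorm (fun ξ : E3 => (jb ξ ^ 2)⁻¹) 2 volume *
      eLpNorm (fun ξ => ((jb ξ ^ 2 : ℝ) : ℂ) * G ξ) 2 volume := by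
  refine le_trans ?_ (lintegral_enorm_le_weight hG.aestronglyMeasurable)
  rw [Real.fourierInv_eq]
  refine (enorm_integral_le_lintegral_enorm _).trans (le_of_eq ?_)
  refine lintegral_congr fun ξ => ?_
  rw [← ofReal_norm, ← ofReal_norm, Circle.norm_smul]

theorem hasSpectrum_combination {f f' h : E3 → ℝ} {g g' k : E3 → ℂ}
    (hf : HasSpectrum (fun x => (f x : ℂ)) g) (hf' : HasSpectrum (fun x => (f' x : ℂ)) g')
    (hh : HasSpectrum (fun x => (h x : ℂ)) k) (τ : ℝ) :
    HasSpectrum (fun x => (((f x - f' x) / τ - h x : ℝ) : ℂ))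
      (fun ξ => ((τ : ℂ)⁻¹ * (g ξ - g' ξ)) - k ξ) := by
  refine (((hf.sub hf').const_mul (τ : ℂ)⁻¹).sub hh).congr_fun (funext fun x => ?_)
  push_cast
  ring

theorem enorm_velocity_combination_le {v v' w : E3 → ℝ} (hv : IsHInfty v) (hv' : IsHInfty v')
    (hw : IsHInfty w) (τ : ℝ) (i : Fin 3) (x : E3) :
    ‖(velocity v x i - velocity v' x i) / τ - velocity w x i‖ₑ ≤
      eLpNorm (fun ξ : E3 => (jb ξ ^ 2)⁻¹) 2 volume * (ENNReal.ofReal (2 * ‖cst‖) *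
        (2 * sobolevNorm 2 fun x => (v x - v' x) / τ - w x)) := by
  have hc := hasSpectrum_combination (hasSpectrum_of_isHInfty hv) (hasSpectrum_of_isHInfty hv')
    (hasSpectrum_of_isHInfty hw) τ
  rw [sobolevNorm_eq_of_hasSpectrum hc]
  refine le_trans ?_ ((enorm_fourierInv_le (rapidL2_velSpec hc.rapid cst i) x).trans
    (mul_le_mul_right (eLpNorm_velSpec_le hc.rapid i 2) _))
  have s {u : E3 → ℝ} (hu : IsHInfty u) :=
    (rapidL2_velSpec (rapidL2_l2Fourier hu) cst i).hasSpectrum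
  have e := ((((s hv).sub (s hv')).const_mul (τ : ℂ)⁻¹).sub (s hw)).eq
  have e' : velSpec cst (fun ξ => ((τ : ℂ)⁻¹ * (l2Fourier (fun y => (v y : ℂ)) ξ -
      l2Fourier (fun y => (v' y : ℂ)) ξ)) - l2Fourier (fun y => (w y : ℂ)) ξ) i =
      fun ξ => (τ : ℂ)⁻¹ * (velSpec cst (l2Fourier fun y => (v y : ℂ)) i ξ -
        velSpec cst (l2Fourier fun y => (v' y : ℂ)) i ξ) -
        velSpec cst (l2Fourier fun y => (w y : ℂ)) i ξ := by
    funext ξ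
    rw [velSpec_sub, velSpec_const_mul, velSpec_sub]
  rw [e', ← e, ← ofReal_norm, ← ofReal_norm]
  refine ENNReal.ofReal_le_ofReal ?_
  refine le_trans (le_of_eq ?_) (Complex.abs_re_le_norm _)
  rw [Real.norm_eq_abs, Complex.sub_re, ← Complex.ofReal_inv, Complex.re_ofReal_mul,
    Complex.sub_re]
  simp only [velocity]
  congr 1
  ring

theorem hasDerivWithinAt_velocity {v : ℝ → E3 → ℝ} {w : E3 → ℝ} {I : Set ℝ} {t : ℝ}
    (hv : ∀ s ∈ I, IsHInfty (v s)) (ht : t ∈ I) (hw : IsHInfty w)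
    (h : HasSobolevDerivWithinAt v w I t) (x : E3) :
    HasDerivWithinAt (fun s => velocity (v s) x) (velocity w x) I t := by
  rw [hasDerivWithinAt_iff_hasFDerivWithinAt, hasFDerivWithinAt_euclidean]
  intro i
  suffices HasDerivWithinAt (fun s => velocity (v s) x i) (velocity w x i) I t by
    refine this.hasFDerivWithinAt.congr_fderiv ?_
    ext
    simp
  rw [hasDerivWithinAt_iff_tendsto_slope, tendsto_iff_edist_tendsto_0]
  have hK : eLpNorm (fun ξ : E3 => (jb ξ ^ 2)⁻¹) 2 volume ≠ ⊤ := memLp_jb_inv_sq.2.ne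
  have h0 := ENNReal.Tendsto.const_mul (a := eLpNorm (fun ξ : E3 => (jb ξ ^ 2)⁻¹) 2 volume)
    (ENNReal.Tendsto.const_mul (a := ENNReal.ofReal (2 * ‖cst‖))
      -- Order 2 is enough: the weighted L² norm of order 2 bounds the L¹ norm of a spectrum, hence
      -- the function uniformly, and `velocity` is linear with bounded symbols.
      (ENNReal.Tendsto.const_mul (a := 2) (h 2) (Or.inr (by simp))) (Or.inr ENNReal.ofReal_ne_top))
    (Or.inr hK)
  simp only [mul_zero] at h0
  refine tendsto_of_tendsto_of_tendsto_of_le_of_le' tendsto_const_nhds h0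
    (Eventually.of_forall fun _ => zero_le) ?_
  filter_upwards [self_mem_nhdsWithin] with s hs
  rw [edist_eq_enorm_sub, slope_def_field]
  exact enorm_velocity_combination_le (hv s hs.1) (hv t ht) hw (s - t) i x

theorem sobolevNorm_sub_le {v v' w : E3 → ℝ} (hv : IsHInfty v) (hv' : IsHInfty v')
    (hw : IsHInfty w) {τ : ℝ} (hτ : τ ≠ 0) (m : ℕ) :
    sobolevNorm m (fun x => v x - v' x) ≤
      ‖τ‖ₑ * (sobolevNorm m (fun x => (v x - v' x) / τ - w x) + sobolevNorm m w) := by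
  have hc := hasSpectrum_combination (hasSpectrum_of_isHInfty hv) (hasSpectrum_of_isHInfty hv')
    (hasSpectrum_of_isHInfty hw) τ
  have hs : HasSpectrum (fun x => ((v x - v' x : ℝ) : ℂ)) _ :=
    ((hasSpectrum_of_isHInfty hv).sub (hasSpectrum_of_isHInfty hv')).congr_fun
      (funext fun x => by push_cast; rfl)
  rw [sobolevNorm_eq_of_hasSpectrum hc, sobolevNorm_eq_of_hasSpectrum hs,
    sobolevNorm_eq_of_hasSpectrum (hasSpectrum_of_isHInfty hw)]
  have hτ' : ‖τ‖ₑ = ‖(τ : ℂ)‖ₑ := by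
    rw [← ofReal_norm, ← ofReal_norm, Complex.norm_real]
  refine le_trans (le_of_eq ?_) (mul_le_mul_right (eLpNorm_add_le (hc.rapid m).1
    ((rapidL2_l2Fourier hw) m).1 (by norm_num)) _)
  rw [hτ', ← eLpNorm_const_smul]
  refine congrArg (fun F : E3 → ℂ => eLpNorm F 2 volume) (funext fun ξ => ?_)
  have : (τ : ℂ) ≠ 0 := by exact_mod_cast hτ
  simp only [Pi.smul_apply, Pi.add_apply, smul_eq_mul]
  field_simp
  ring

theorem sobolevNorm_velocity_sub_le {v v' : E3 → ℝ} (hv : IsHInfty v) (hax : IsAxisymmetric v)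
    (hv' : IsHInfty v') (hax' : IsAxisymmetric v') (i : Fin 3) (m : ℕ) :
    sobolevNorm m (fun x => velocity v x i - velocity v' x i) ≤
      ENNReal.ofReal (2 * ‖cst‖) * (2 * sobolevNorm m fun x => v x - v' x) := by
  have hs : HasSpectrum (fun x => ((v x - v' x : ℝ) : ℂ)) _ :=
    ((hasSpectrum_of_isHInfty hv).sub (hasSpectrum_of_isHInfty hv')).congr_fun
      (funext fun x => by push_cast; rfl)
  have hu : HasSpectrum (fun x => ((velocity v x i - velocity v' x i : ℝ) : ℂ)) _ :=
    ((hasSpectrum_velocity hv hax i).sub (hasSpectrum_velocity hv' hax' i)).congr_fun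
      (funext fun x => by push_cast; rfl)
  rw [sobolevNorm_eq_of_hasSpectrum hs, sobolevNorm_eq_of_hasSpectrum hu]
  simp only [← velSpec_sub]
  exact eLpNorm_velSpec_le hs.rapid i m

theorem tendsto_sobolevNorm_velocity_sub {v : ℝ → E3 → ℝ} {w : E3 → ℝ} {I : Set ℝ} {t : ℝ}
    (hv : ∀ s ∈ I, IsHInfty (v s)) (hax : ∀ s ∈ I, IsAxisymmetric (v s)) (ht : t ∈ I)
    (hw : IsHInfty w) (h : HasSobolevDerivWithinAt v w I t) (i : Fin 3) (m : ℕ) :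
    Tendsto (fun s => sobolevNorm m fun x => velocity (v s) x i - velocity (v t) x i)
      (𝓝[I] t) (𝓝 0) := by
  have h1 : Tendsto (fun s : ℝ => ENNReal.ofReal (2 * ‖cst‖) * (2 * (‖s - t‖ₑ *
      (1 + sobolevNorm m w)))) (𝓝[I] t) (𝓝 0) := by
    have h2 : Tendsto (fun s : ℝ => ‖s - t‖ₑ) (𝓝[I] t) (𝓝 0) := by
      have : Continuous fun s : ℝ => ‖s - t‖ₑ := by fun_prop
      simpa using (this.tendsto t).mono_left (nhdsWithin_le_nhds (s := I))
    have h3 := ENNReal.Tendsto.const_mul (a := ENNReal.ofReal (2 * ‖cst‖))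
      (ENNReal.Tendsto.const_mul (a := 2) (ENNReal.Tendsto.mul_const h2
        (b := 1 + sobolevNorm m w)
        (Or.inr (ENNReal.add_ne_top.2 ⟨by simp, (hw.sobolevNorm_lt_top m).ne⟩)))
        (Or.inr (by simp))) (Or.inr ENNReal.ofReal_ne_top)
    simpa only [zero_mul, mul_zero] using h3
  refine tendsto_of_tendsto_of_tendsto_of_le_of_le' tendsto_const_nhds h1
    (Eventually.of_forall fun _ => zero_le) ?_
  -- Near t the difference quotient is within 1 of w, which gives a local Lipschitz bound. Time t
  -- itself, excluded from the derivative's filter, is treated apart.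
  have h4 : ∀ᶠ s in 𝓝[I] t, s ≠ t →
      sobolevNorm m (fun x => (v s x - v t x) / (s - t) - w x) < 1 := by
    have := (h m).eventually_lt_const zero_lt_one
    rw [sdiff_eq, nhdsWithin_inter', eventually_inf_principal] at this
    exact this
  filter_upwards [h4, self_mem_nhdsWithin] with s hs hsI
  refine (sobolevNorm_velocity_sub_le (hv s hsI) (hax s hsI) (hv t ht) (hax t ht) i m).trans ?_
  gcongr
  by_cases hst : s = t
  · subst hst
    have h0 : sobolevNorm m (fun _ => (0 : ℝ)) = 0 := by
      rw [sobolevNorm_eq_of_hasSpectrum (g := fun _ => 0) (by simpa using HasSpectrum.zero)]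
      simp
    simp [h0]
  · refine (sobolevNorm_sub_le (hv s hsI) (hv t ht) hw (sub_ne_zero.2 hst) m).trans ?_
    gcongr
    exact (hs hst).le

theorem sobolevNorm_le_velocity {v : E3 → ℝ} (hv : IsHInfty v) (hax : IsAxisymmetric v) (m : ℕ) :
    sobolevNorm m v ≤ 2 * ∑ i, sobolevNorm m fun x => velocity v x i := by
  have hu := hasSpectrum_velocity hv hax
  rw [sobolevNorm_eq_of_hasSpectrum (hasSpectrum_of_isHInfty hv)]
  simp only [fun i => sobolevNorm_eq_of_hasSpectrum (hu i) m]
  set G := l2Fourier fun y => (v y : ℂ)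
  calc _ ≤ ENNReal.ofReal 2 * eLpNorm (∑ i, fun ξ => ‖((jb ξ ^ m : ℝ) : ℂ) * velSpec cst G i ξ‖)
          2 volume := by
        refine eLpNorm_le_mul_eLpNorm_of_ae_le_mul ?_ 2
        filter_upwards [ae_coord_zero_ne_zero] with ξ hξ
        have h0 : 0 ≤ jb ξ ^ m := (pow_pos (jb_pos ξ) m).le
        have h1 := mul_le_mul_of_nonneg_left (norm_le_sum_velSpec G hξ) h0
        rw [Finset.sum_apply, Real.norm_of_nonneg (Finset.sum_nonneg fun _ _ => norm_nonneg _)]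
        simp only [norm_mul, Complex.norm_real, Real.norm_of_nonneg h0, ← Finset.mul_sum]
        linarith
    _ ≤ _ := by
        rw [ENNReal.ofReal_ofNat]
        gcongr
        refine (eLpNorm_sum_le (fun i _ => ((hu i).rapid m).1.norm) (by norm_num)).trans
          (le_of_eq ?_)
        simp only [eLpNorm_norm]

theorem isNavierStokesSolution_velocity {ν T : ℝ} {v₀ : E3 → ℝ} {v : ℝ → E3 → ℝ}
    (hv : IsScalarSolution ν T v₀ v) :
    ∃ p : ℝ → E3 → ℝ,
      IsNavierStokesSolution ν T (velocity v₀) (fun t => velocity (v t)) p := by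
  classical
  refine ⟨fun t => if h : t ∈ Ico 0 T then pressure (hv.smooth t h) (hv.axisymmetric t h) else 0,
    ⟨by simp only [hv.initial], fun t ht => ⟨contDiff_velocity (hv.smooth t ht) (hv.axisymmetric t ht),
      isHInfty_velocity (hv.smooth t ht) (hv.axisymmetric t ht)⟩, fun t ht => ?_,
      fun t ht i m => ?_, fun t ht => divergence_velocity (hv.smooth t ht) (hv.axisymmetric t ht),
      fun t ht x => ?_⟩⟩
  · simp only [dif_pos ht]
    exact contDiff_pressure _ _
  · obtain ⟨w, hw, hd, -⟩ := hv.equation t ht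
    exact tendsto_sobolevNorm_velocity_sub hv.smooth hv.axisymmetric ht hw hd i m
  · obtain ⟨w, hw, hd, he⟩ := hv.equation t ht
    refine ⟨velocity w x, hasDerivWithinAt_velocity hv.smooth ht hw hd x, ?_⟩
    simp only [dif_pos ht]
    exact momentum_velocity _ _ hw he x

theorem theorem1 (ν : ℝ) (hν : 0 ≤ ν) (v₀ : E3 → ℝ) (hv₀ : ContDiff ℝ ∞ v₀)
    (hv₀_L2 : MemLp v₀ 2 volume) (hv₀_axi : IsAxisymmetric v₀) (hblow : ScalarBlowsUp ν v₀) :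
    ∃ u₀ : E3 → E3, ContDiff ℝ ∞ u₀ ∧ MemLp u₀ 2 volume ∧ (∀ x : E3, divergence u₀ x = 0) ∧
      NavierStokesBlowsUp ν u₀ := by
  obtain ⟨T, hT, v, hv, m, hm⟩ := hblow
  have h0 : IsHInfty v₀ := hv.initial ▸ hv.smooth 0 ⟨le_rfl, hT⟩
  obtain ⟨p, hp⟩ := isNavierStokesSolution_velocity hv
  refine ⟨velocity v₀, contDiff_velocity h0 hv₀_axi, memLp_velocity h0 hv₀_axi,
    divergence_velocity h0 hv₀_axi, T, hT, _, p, hp, m, fun M => ?_⟩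
  -- The threshold 2M absorbs the constant 2 in the bound of the norm of v by that of the velocity.
  refine ((hm (2 * M)).and_eventually (Ioo_mem_nhdsLT hT)).mono fun t ⟨h1, h2⟩ => ?_
  have ht : t ∈ Ico 0 T := ⟨h2.1.le, h2.2⟩
  have h3 := h1.trans_le (sobolevNorm_le_velocity (hv.smooth t ht) (hv.axisymmetric t ht) m)
  rw [ENNReal.coe_mul, ENNReal.coe_ofNat] at h3
  exact lt_of_mul_lt_mul_left' h3
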